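/- Let $d\ge 1$ and $p\ge 0$ be integers, and let $\lambda_d$ denote Lebesgue measure on $\mathbb{R}^d$. For a bounded Borel set $B\subseteq\mathbb{R}^d$ with $\lambda_d(B)>0$, points $x_1,\dots,x_n\in\mathbb{R}^d$ ($n\ge 1$) are said to form an averaging set of $B$ of degree $p$ and size $n$ if $$\frac{1}{\lambda_d(B)}\int_B f(x)\,dx=\frac1n\sum_{k=1}^n f(x_k)$$ for every real polynomial $f$ in $d$ variables of degree at most $p$. (1) For every $C>0$ there is an $N\in\mathbb{N}$, depending only on $d$, $p$ and $C$, such that for every $n\ge N$ and every bounded Borel set $B\subseteq\mathbb{R}^d$ with $\lambda_d(B)>0$, $\lambda_d(\partial B)=0$ and $$\frac{\operatorname{diam}(B)^d}{\lambda_d(B)}\le C\qquad\text{or}\qquad\frac{\lambda_d(\operatorname{conv}(B))}{\lambda_d(B)}\le C,$$ there exist $n$ pairwise different points $x_1,\dots,x_n\in B$ that form an averaging set of $B$ of degree $p$. (2) In particular, there is an $N\in\mathbb{N}$, depending only on $d$ and $p$, such that for every $n\ge N$ and every bounded convex Borel set $B\subseteq\mathbb{R}^d$ with $\lambda_d(B)>0$,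 there exist $n$ pairwise different points $x_1,\dots,x_n\in B$ that form an averaging set of $B$ of degree $p$. -/

import Mathlib

open MeasureTheory

/-- The points `x 0, …, x (n - 1)` of `ℝ^d` form an averaging set of size `n ≥ 1` of the finite
nonzero measure `μ` and the family `f` of `μ`-integrable functions: the mean of each `f j` with
respect to `μ` is the equal-weight mean of its values at the points. Distinctness of the points is
not part of this definition and is stated separately where it is wanted. -/
structure IsAveragingSetFor {d n : ℕ} {J : Type*} (μ : Measure (EuclideanSpace ℝ (Fin d)))
    (f : J → EuclideanSpace ℝ (Fin d) → ℝ) (x : Fin n → EuclideanSpace ℝ (Fin d)) : Prop where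
  size_pos : 0 < n
  finite : IsFiniteMeasure μ
  ne_zero : μ ≠ 0
  integrable : ∀ j, Integrable (f j) μ
  average_eq : ∀ j, (1 / μ.real Set.univ) * ∫ y, f j y ∂μ = (1 / (n : ℝ)) * ∑ k, f j (x k)

/-- The family of all real polynomial functions on `ℝ^d` of total degree at most `p`. -/
noncomputable def polyFun (d p : ℕ) (P : {P : MvPolynomial (Fin d) ℝ // P.totalDegree ≤ p})
    (x : EuclideanSpace ℝ (Fin d)) : ℝ :=
  MvPolynomial.eval (fun i => x i) P.1

/-- Averaging set of the set `B ⊆ ℝ^d` of degree `p`: averaging set of Lebesgue measure restricted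
to `B` and the polynomials of degree at most `p`. -/
def IsAveragingSet {d n : ℕ} (B : Set (EuclideanSpace ℝ (Fin d))) (p : ℕ)
    (x : Fin n → EuclideanSpace ℝ (Fin d)) : Prop :=
  IsAveragingSetFor (volume.restrict B) (polyFun d p) x

/-! Let `φ` be the vector of nonconstant monomials and let `X` be uniformly distributed on `B`. An
averaging set is a choice of points of `B` at which the sum of the centred values `φ (x k) - 𝔼 φ(X)`
vanishes. For `n` independent copies of `X` this sum obeys a local limit theorem, so for large `n`
its density at `0` is positive, and `0` should be attained. The work lies in making `n` independent
of `B`, although the characteristic function of `φ(X)` depends on a set without any regularity.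

Uniformity comes from domination. If `B` lies in a fixed ball and its volume is bounded below, its
normalized Lebesgue measure lies below a multiple of one measure `μ₀`, the law of a uniform point of
a larger ball moved along the curve `t ↦ (t ^ (p+1)^i)ᵢ`. On every translate of this curve the
monomials become polynomials in `t` of pairwise different degrees, so the characteristic function of
`φ` under `μ₀` decays like a power (`exists_dominating_measure`). Domination does not pass to
characteristic functions pointwise, but it does after symmetrization and pairing with positive
definite weights. This gives a uniform gap below modulus one (`exists_norm_charAlong_sq_le`) and a
uniform bound on high even moments (`integral_norm_charAlong_pow_mul_mono`), which feed the local
limit bound `exists_gaussian_integral_pow_lower_bound`.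

The density at `0` is tested by Gaussian kernels of shrinking width. Tuples with two points outside
a large compact set of off-diagonal pairs of `B` carry little of it, so a compact set of good tuples
carries the rest. If the sum did not vanish there, it would stay away from `0`, and narrow kernels
would see nothing (`exists_injective_sum_eq_zero`).

Being an averaging set is affinely invariant. A bound on `diam(B)^d / λ(B)` is brought into
normalized position by a homothety, a bound on `λ(conv B) / λ(B)` by a simplex frame of maximal
volume (`exists_affine_normalization`). -/

/-! ### Oscillatory integrals with polynomial phase -/

/-- Integration by parts with `h = q' / (q' ^ 2 + θ ^ 2)` in place of `1 / q'`. The regularization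
is harmless at stationary points and leaves the defect `1 - q' * h = θ ^ 2 / (q' ^ 2 + θ ^ 2)`,
which is concentrated where `q'` is small. The other two terms bound the boundary values and `h'`.
-/
theorem norm_integral_exp_I_le {q q' q'' : ℝ → ℝ} {D θ : ℝ} (hθ : 0 < θ)
    (hq : ∀ t, HasDerivAt q (q' t) t) (hq' : ∀ t, HasDerivAt q' (q'' t) t)
    (hc : Continuous q'') (hD : ∀ t ∈ Set.Icc (0 : ℝ) 1, |q'' t| ≤ D) :
    ‖∫ t in (0 : ℝ)..1, Complex.exp (Complex.I * q t)‖ ≤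
      1 / θ + D / θ ^ 2 + ∫ t in (0 : ℝ)..1, θ ^ 2 / (q' t ^ 2 + θ ^ 2) := by
  have hcq : Continuous q := continuous_iff_continuousAt.2 fun t => (hq t).continuousAt
  have hcq' : Continuous q' := continuous_iff_continuousAt.2 fun t => (hq' t).continuousAt
  have hpos : ∀ t, 0 < q' t ^ 2 + θ ^ 2 := fun t => by positivity
  set h : ℝ → ℝ := fun t => q' t / (q' t ^ 2 + θ ^ 2) with hh
  set h' : ℝ → ℝ := fun t => q'' t * (θ ^ 2 - q' t ^ 2) / (q' t ^ 2 + θ ^ 2) ^ 2 with hh'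
  have hderiv : ∀ t, HasDerivAt h (h' t) t := by
    intro t
    refine ((hq' t).div (((hq' t).pow 2).add_const (θ ^ 2)) (hpos t).ne').congr_deriv ?_
    simp only [hh']
    congr 1
    simp
    ring
  have hch : Continuous h := hcq'.div (by fun_prop) fun t => (hpos t).ne'
  have hch' : Continuous h' := (by fun_prop : Continuous fun t => q'' t * (θ ^ 2 - q' t ^ 2)).div
    (by fun_prop) fun t => (pow_pos (hpos t) 2).ne'
  set e : ℝ → ℂ := fun t => Complex.exp (Complex.I * q t) with he
  have hce : Continuous e := by fun_prop
  have hne : ∀ t, ‖e t‖ = 1 := fun t => by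
    simp only [he]; rw [mul_comm]; exact Complex.norm_exp_ofReal_mul_I _
  have hde : ∀ t, HasDerivAt e (Complex.I * q' t * e t) t := by
    intro t
    refine (((hq t).ofReal_comp).const_mul Complex.I).cexp.congr_deriv ?_
    simp only [he]; ring
  have hdF : ∀ t, HasDerivAt (fun t => e t * (h t : ℂ))
      (Complex.I * (q' t * h t : ℝ) * e t + e t * (h' t : ℂ)) t := by
    intro t
    refine ((hde t).mul (hderiv t).ofReal_comp).congr_deriv ?_
    push_cast; ring
  have hFTC := intervalIntegral.integral_eq_sub_of_hasDerivAt (a := 0) (b := 1)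
    (fun t _ => hdF t) (Continuous.intervalIntegrable (by fun_prop) _ _)
  have hsplit : ∀ t, e t = -Complex.I * (Complex.I * (q' t * h t : ℝ) * e t + e t * (h' t : ℂ))
      + Complex.I * (e t * (h' t : ℂ)) + e t * ((θ ^ 2 / (q' t ^ 2 + θ ^ 2) : ℝ) : ℂ) := by
    intro t
    have h1 : q' t * h t + θ ^ 2 / (q' t ^ 2 + θ ^ 2) = 1 := by
      simp only [hh]; field_simp
    have h2 : (((q' t * h t : ℝ) : ℂ) + ((θ ^ 2 / (q' t ^ 2 + θ ^ 2) : ℝ) : ℂ)) = 1 := by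
      rw [← Complex.ofReal_add, h1]; simp
    have h3 : -Complex.I * (Complex.I * ((q' t * h t : ℝ) : ℂ) * e t) = ((q' t * h t : ℝ) : ℂ) * e t := by
      rw [← mul_assoc, ← mul_assoc, neg_mul, Complex.I_mul_I]; ring
    rw [mul_add, h3]
    linear_combination (-e t) * h2
  have hcr : Continuous fun t => θ ^ 2 / (q' t ^ 2 + θ ^ 2) :=
    continuous_const.div (by fun_prop) fun t => (hpos t).ne'
  have hEq : ∫ t in (0 : ℝ)..1, e t = -Complex.I * (e 1 * (h 1 : ℂ) - e 0 * (h 0 : ℂ))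
      + (∫ t in (0 : ℝ)..1, Complex.I * (e t * (h' t : ℂ)))
      + ∫ t in (0 : ℝ)..1, e t * ((θ ^ 2 / (q' t ^ 2 + θ ^ 2) : ℝ) : ℂ) := by
    rw [← hFTC, ← intervalIntegral.integral_const_mul, ← intervalIntegral.integral_add,
      ← intervalIntegral.integral_add]
    · exact intervalIntegral.integral_congr fun t _ => hsplit t
    all_goals exact Continuous.intervalIntegrable (by fun_prop) _ _
  have hhb : ∀ t, |h t| ≤ 1 / (2 * θ) := by
    intro t
    simp only [hh]
    rw [abs_div, abs_of_pos (hpos t), div_le_div_iff₀ (hpos t) (by positivity)]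
    nlinarith [sq_nonneg (|q' t| - θ), sq_abs (q' t)]
  have hh'b : ∀ t ∈ Set.Icc (0 : ℝ) 1, |h' t| ≤ D / θ ^ 2 := by
    intro t ht
    simp only [hh']
    rw [abs_div, abs_mul, abs_of_pos (pow_pos (hpos t) 2),
      div_le_div_iff₀ (pow_pos (hpos t) 2) (by positivity)]
    have h1 : |θ ^ 2 - q' t ^ 2| ≤ q' t ^ 2 + θ ^ 2 := by
      rw [abs_le]; constructor <;> nlinarith [sq_nonneg (q' t), sq_nonneg θ]
    have h2 : θ ^ 2 ≤ q' t ^ 2 + θ ^ 2 := by nlinarith [sq_nonneg (q' t)]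
    have h3 := hD t ht
    have h4 : 0 ≤ D := (abs_nonneg _).trans h3
    calc |q'' t| * |θ ^ 2 - q' t ^ 2| * θ ^ 2
        ≤ D * (q' t ^ 2 + θ ^ 2) * (q' t ^ 2 + θ ^ 2) := by gcongr
      _ = _ := by ring
  rw [hEq]
  refine (norm_add_le _ _).trans (add_le_add ((norm_add_le _ _).trans (add_le_add ?_ ?_)) ?_)
  · rw [norm_mul, norm_neg, Complex.norm_I, one_mul]
    refine (norm_sub_le _ _).trans ?_
    rw [norm_mul, norm_mul, hne, hne, one_mul, one_mul, Complex.norm_real, Complex.norm_real]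
    have e1 := hhb 0
    have e2 := hhb 1
    have e3 : 1 / θ = 1 / (2 * θ) + 1 / (2 * θ) := by field_simp; norm_num
    rw [e3]
    exact add_le_add e2 e1
  · have := intervalIntegral.norm_integral_le_of_norm_le_const (a := 0) (b := 1)
      (f := fun t => Complex.I * (e t * (h' t : ℂ))) (C := D / θ ^ 2) (by
        intro t ht
        rw [norm_mul, norm_mul, hne, Complex.norm_I, one_mul, one_mul, Complex.norm_real]
        rw [Set.uIoc_of_le zero_le_one] at ht
        exact hh'b t ⟨ht.1.le, ht.2⟩)
    simpa using this
  · refine (intervalIntegral.norm_integral_le_integral_norm zero_le_one).trans (le_of_eq ?_)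
    refine intervalIntegral.integral_congr fun t _ => ?_
    change ‖e t * ((θ ^ 2 / (q' t ^ 2 + θ ^ 2) : ℝ) : ℂ)‖ = _
    rw [norm_mul, hne, one_mul, Complex.norm_real, Real.norm_eq_abs,
      abs_of_nonneg (div_nonneg (sq_nonneg _) (hpos t).le)]

/-- Greedy choice: the `r`-balls around the points chosen so far are too small to cover `Z`. -/
theorem exists_separated_finset (k : ℕ) {Z : Set ℝ} {r : ℝ} (hr : 0 < r)
    (h : ENNReal.ofReal (2 * r * k) < volume Z) :
    ∃ s : Finset ℝ, s.card = k + 1 ∧ ↑s ⊆ Z ∧ ∀ x ∈ s, ∀ y ∈ s, x ≠ y → r ≤ |x - y| := by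
  induction k with
  | zero =>
    obtain ⟨x, hx⟩ := nonempty_of_measure_ne_zero (bot_le.trans_lt h).ne'
    exact ⟨{x}, by simp, by simpa using hx, by simp +contextual⟩
  | succ k ih =>
    obtain ⟨s, hs, hsZ, hsep⟩ := ih (lt_of_le_of_lt (ENNReal.ofReal_le_ofReal (by
      push_cast; nlinarith)) h)
    have hU : volume (⋃ x ∈ s, Metric.ball x r) < volume Z := by
      refine lt_of_le_of_lt (measure_biUnion_finset_le _ _) (lt_of_le_of_lt (le_of_eq ?_) h)
      simp only [Real.volume_ball, Finset.sum_const, hs, nsmul_eq_mul]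
      rw [← ENNReal.ofReal_natCast, ← ENNReal.ofReal_mul (by positivity)]
      congr 1; push_cast; ring
    obtain ⟨x, hxZ, hx⟩ : ∃ x ∈ Z, x ∉ ⋃ x ∈ s, Metric.ball x r := by
      by_contra! hcon
      exact absurd (measure_mono hcon) (not_le.2 hU)
    simp only [Set.mem_iUnion, Metric.mem_ball, not_exists, not_lt, Real.dist_eq] at hx
    have hxs : x ∉ s := fun hxs => by
      have := hx x hxs
      simp at this; linarith
    refine ⟨insert x s, by rw [Finset.card_insert_of_notMem hxs, hs], ?_, ?_⟩
    · simpa [Set.insert_subset_iff] using ⟨hxZ, hsZ⟩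
    · intro a ha b hb hab
      rcases Finset.mem_insert.1 ha with ha | ha <;> rcases Finset.mem_insert.1 hb with hb | hb
      · exact absurd (ha.trans hb.symm) hab
      · rw [ha]; exact hx b hb
      · rw [hb, abs_sub_comm]; exact hx a ha
      · exact hsep a ha b hb hab

open Polynomial in
theorem abs_coeff_prod_linear_le {ι : Type*} (t : Finset ι) (a y : ι → ℝ) {K : ℝ}
    (ha : ∀ j ∈ t, |a j| ≤ K) (hy : ∀ j ∈ t, |y j| ≤ 1) (n : ℕ) :
    |(∏ j ∈ t, (C (a j) * (X - C (y j)))).coeff n| ≤ (2 * K) ^ t.card := by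
  classical
  induction t using Finset.induction_on generalizing n with
  | empty => simp [coeff_one]; split_ifs <;> simp
  | insert j t hj ih =>
    rw [Finset.prod_insert hj, Finset.card_insert_of_notMem hj]
    have ih' := ih (fun i hi => ha i (Finset.mem_insert_of_mem hi))
      (fun i hi => hy i (Finset.mem_insert_of_mem hi))
    set P := ∏ j ∈ t, (C (a j) * (X - C (y j)))
    have h1 := ha j (Finset.mem_insert_self _ _)
    have h2 := hy j (Finset.mem_insert_self _ _)
    have hK : 0 ≤ K := (abs_nonneg _).trans h1
    have h0 : 0 ≤ (2 * K) ^ t.card := by positivity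
    have key : ∀ z, |z| ≤ (2 * K) ^ t.card →
        |a j * (z - y j * P.coeff n)| ≤ (2 * K) ^ (t.card + 1) := by
      intro z hz
      rw [abs_mul]
      calc |a j| * |z - y j * P.coeff n| ≤ K * ((2 * K) ^ t.card + 1 * (2 * K) ^ t.card) := by
            refine mul_le_mul h1 ((abs_sub _ _).trans (add_le_add hz ?_)) (abs_nonneg _) hK
            rw [abs_mul]
            exact mul_le_mul h2 (ih' n) (abs_nonneg _) zero_le_one
        _ = _ := by ring
    rw [mul_assoc, coeff_C_mul, sub_mul, coeff_sub, coeff_C_mul]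
    cases n with
    | zero => rw [coeff_X_mul_zero]; exact key 0 (by simpa using h0)
    | succ n => rw [coeff_X_mul]; exact key _ (ih' n)

open Polynomial in
-- Lagrange interpolation at the `k + 1` nodes; separation bounds the coefficients of each basis
-- polynomial by `(2 / r) ^ k`.
theorem abs_coeff_le_of_abs_eval_le {k : ℕ} {g : ℝ[X]} (hg : g.natDegree ≤ k) {s : Finset ℝ}
    (hs : s.card = k + 1) (hs1 : ∀ x ∈ s, |x| ≤ 1) {r σ : ℝ} (hr : 0 < r)
    (hsep : ∀ x ∈ s, ∀ y ∈ s, x ≠ y → r ≤ |x - y|) (hσ : ∀ x ∈ s, |g.eval x| ≤ σ) (n : ℕ) :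
    |g.coeff n| ≤ (k + 1) * σ * (2 / r) ^ k := by
  have hint : g = Lagrange.interpolate s id (fun x => g.eval x) := by
    refine Lagrange.eq_interpolate (fun a _ b _ h => h) ?_
    rw [hs]
    exact lt_of_le_of_lt degree_le_natDegree (by exact_mod_cast Nat.lt_succ_of_le hg)
  rw [hint, Lagrange.interpolate_apply, finsetSum_coeff]
  refine (Finset.abs_sum_le_sum_abs _ _).trans ?_
  have : ∀ x ∈ s, |(C (g.eval x) * Lagrange.basis s id x).coeff n| ≤ σ * (2 / r) ^ k := by
    intro x hx
    rw [coeff_C_mul, abs_mul]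
    refine mul_le_mul (hσ x hx) ?_ (abs_nonneg _) ((abs_nonneg _).trans (hσ x hx))
    have := abs_coeff_prod_linear_le (s.erase x) (fun y => (x - y)⁻¹) (fun y => y) (K := 1 / r)
      (fun y hy => by
        have := hsep x hx y (Finset.mem_of_mem_erase hy) (Finset.ne_of_mem_erase hy).symm
        rw [abs_inv, ← one_div]
        exact one_div_le_one_div_of_le hr this)
      (fun y hy => hs1 y (Finset.mem_of_mem_erase hy)) n
    rw [Finset.card_erase_of_mem hx, hs] at this
    rw [Nat.add_sub_cancel, mul_one_div] at this
    exact this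
  refine (Finset.sum_le_sum this).trans ?_
  rw [Finset.sum_const, hs, nsmul_eq_mul]
  push_cast
  exact le_of_eq (by ring)

open Polynomial in
-- A larger sublevel set would contain `k + 1` points that are `w`-separated, and the interpolation
-- bound would make every coefficient at most `w / 2 < 1`; the level is calibrated for this.
theorem volume_sublevel_le {k : ℕ} {g : ℝ[X]} (hg : g.natDegree ≤ k) {n : ℕ}
    (hn : 1 ≤ |g.coeff n|) {w : ℝ} (hw : 0 < w) (hw1 : w ≤ 1) :
    volume {t ∈ Set.Icc (0 : ℝ) 1 | |g.eval t| ≤ w ^ (k + 1) / ((k + 1) * 2 ^ (k + 1))} ≤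
      ENNReal.ofReal (2 * w * k) := by
  by_contra! hcon
  obtain ⟨s, hs, hsZ, hsep⟩ := exists_separated_finset k hw hcon
  have := abs_coeff_le_of_abs_eval_le hg hs
    (fun x hx => by have := (hsZ hx).1; rw [abs_le]; constructor <;> linarith [this.1, this.2])
    hw hsep (fun x hx => (hsZ hx).2) n
  have h2 : ((k : ℝ) + 1) * (w ^ (k + 1) / ((k + 1) * 2 ^ (k + 1))) * (2 / w) ^ k = w / 2 := by
    rw [div_pow]
    field_simp
    ring
  rw [h2] at this
  linarith

open Polynomial in
/-- Power decay of polynomial oscillatory integrals on the unit interval. -/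
theorem exists_norm_integral_exp_polynomial_le (k : ℕ) :
    ∃ (C : ℝ) (M : ℕ), 0 < C ∧ 0 < M ∧ ∀ (w : ℝ) (Q : ℝ[X]) (n : ℕ), 0 < w → w ≤ 1 →
      Q.natDegree ≤ k → (1 / w) ^ M ≤ |Q.coeff (n + 1)| →
      ‖∫ t in (0 : ℝ)..1, Complex.exp (Complex.I * (Q.eval t : ℝ))‖ ≤ C * w := by
  set c : ℝ := 1 / ((k + 1) * 2 ^ (k + 1)) with hc
  have hc0 : 0 < c := by positivity
  set G : ℝ := (k + 1) * (k ^ 2 : ℝ) with hG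
  have hG0 : 0 ≤ G := by positivity
  have hc1 : c ≤ 1 := by
    rw [hc, div_le_one (by positivity)]
    have h1 : (1 : ℝ) ≤ 2 ^ (k + 1) := one_le_pow₀ (by norm_num)
    have h2 : (1 : ℝ) ≤ k + 1 := by have : (0 : ℝ) ≤ k := by positivity
                                    linarith
    nlinarith
  -- The regularization below is `θ = l * τ` with `τ = c * w ^ (k + 2)`. The exponent `2 * k + 5` is
  -- what makes `l * τ ^ 2 * w / c ^ 2 ≥ 1`, so that the terms `1 / θ` and `D / θ ^ 2` are of order
  -- `w`.
  refine ⟨(1 + G) / c ^ 2 + 1 + 2 * k, 2 * k + 5, by positivity, by positivity, ?_⟩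
  intro w Q n hw hw1 hQ hn
  -- Normalizing by the largest nonconstant coefficient `l` bounds the second derivative by a
  -- multiple of `l` and gives `Q' / l` a coefficient of size at least `1`.
  obtain ⟨j, hj, hmax⟩ := (Finset.range (k + 1)).exists_max_image
    (fun j => |Q.coeff (j + 1)|) ⟨0, by simp⟩
  set l := |Q.coeff (j + 1)| with hl
  have hall : ∀ i, |Q.coeff (i + 1)| ≤ l := by
    intro i
    by_cases hi : i ∈ Finset.range (k + 1)
    · exact hmax i hi
    · rw [coeff_eq_zero_of_natDegree_lt (by simp at hi; omega)]; simp [hl]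
  have hlw : (1 / w) ^ (2 * k + 5) ≤ l := hn.trans (hall n)
  have hl0 : 0 < l := lt_of_lt_of_le (by positivity) hlw
  set σ := c * w ^ (k + 1) with hσ
  have hσ0 : 0 < σ := by positivity
  set τ := σ * w with hτ
  have hτ0 : 0 < τ := by positivity
  have hD : ∀ t ∈ Set.Icc (0 : ℝ) 1, |(derivative (derivative Q)).eval t| ≤ l * G := by
    intro t ht
    have hdeg : (derivative (derivative Q)).natDegree < k + 1 :=
      lt_of_le_of_lt ((natDegree_derivative_le _).trans ((Nat.sub_le _ _).trans
        ((natDegree_derivative_le _).trans (Nat.sub_le _ _)))) (Nat.lt_succ_of_le hQ)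
    rw [eval_eq_sum_range' hdeg]
    refine (Finset.abs_sum_le_sum_abs _ _).trans ?_
    have : ∀ i ∈ Finset.range (k + 1), |(derivative (derivative Q)).coeff i * t ^ i| ≤
        l * k ^ 2 := by
      intro i hi
      rw [abs_mul, coeff_derivative, coeff_derivative]
      have ht1 : |t ^ i| ≤ 1 := by
        rw [abs_pow, abs_of_nonneg ht.1]; exact pow_le_one₀ ht.1 ht.2
      by_cases hik : k < i + 2
      · rw [coeff_eq_zero_of_natDegree_lt (lt_of_le_of_lt hQ hik)]; simp; positivity
      · have hik' : (i : ℝ) + 2 ≤ k := by exact_mod_cast not_lt.1 hik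
        have h3 : |Q.coeff (i + 1 + 1) * ((i + 1 : ℕ) + 1 : ℝ) * ((i : ℝ) + 1)| ≤ l * k * k := by
          rw [abs_mul, abs_mul, abs_of_nonneg (by positivity : (0 : ℝ) ≤ (i : ℝ) + 1),
            abs_of_nonneg (by positivity : (0 : ℝ) ≤ ((i + 1 : ℕ) : ℝ) + 1)]
          push_cast
          have := hall (i + 1)
          gcongr <;> linarith
        calc _ ≤ (l * k * k) * 1 := mul_le_mul h3 ht1 (abs_nonneg _) (by positivity)
          _ = _ := by ring
    refine (Finset.sum_le_sum this).trans (le_of_eq ?_)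
    simp [hG]; ring
  have key := norm_integral_exp_I_le (q := fun t => Q.eval t) (θ := l * τ) (by positivity)
    (fun t => Q.hasDerivAt t) (fun t => (derivative Q).hasDerivAt t)
    (derivative (derivative Q)).continuous hD
  refine key.trans ?_
  have hlw' : 1 ≤ l * w ^ (2 * k + 5) := by
    rwa [one_div, inv_pow, ← one_div, div_le_iff₀ (by positivity)] at hlw
  have hτ2 : 1 ≤ l * τ ^ 2 * w / c ^ 2 := by
    rw [show l * τ ^ 2 * w / c ^ 2 = l * w ^ (2 * k + 5) by
      rw [hτ, hσ]; field_simp; ring]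
    exact hlw'
  have hτ1 : τ ≤ 1 := by
    have : w ^ (k + 1) ≤ 1 := pow_le_one₀ hw.le hw1
    calc c * w ^ (k + 1) * w ≤ 1 * 1 * 1 := by gcongr
      _ = 1 := by norm_num
  have e1 : 1 / (l * τ) ≤ w / c ^ 2 := by
    rw [div_le_iff₀ (by positivity)]
    calc 1 ≤ l * τ ^ 2 * w / c ^ 2 := hτ2
      _ = w / c ^ 2 * (l * τ) * τ := by ring
      _ ≤ w / c ^ 2 * (l * τ) * 1 := by gcongr
      _ = _ := by ring
  have e2 : l * G / (l * τ) ^ 2 ≤ G * (w / c ^ 2) := by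
    rw [div_le_iff₀ (by positivity)]
    calc l * G = l * G * 1 := by ring
      _ ≤ l * G * (l * τ ^ 2 * w / c ^ 2) := by gcongr
      _ = _ := by ring
  set g : ℝ[X] := C l⁻¹ * derivative Q with hg
  have hgdeg : g.natDegree ≤ k := (natDegree_C_mul_le _ _).trans
    ((natDegree_derivative_le _).trans ((Nat.sub_le _ _).trans hQ))
  have hgco : 1 ≤ |g.coeff j| := by
    rw [hg, coeff_C_mul, coeff_derivative, abs_mul, abs_mul, ← hl, abs_of_pos (inv_pos.2 hl0),
      ← mul_assoc, inv_mul_cancel₀ hl0.ne', one_mul, abs_of_nonneg (by positivity)]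
    have : (0 : ℝ) ≤ j := by positivity
    linarith
  have hsub := volume_sublevel_le hgdeg hgco hw hw1
  set Z := {t ∈ Set.Icc (0 : ℝ) 1 | |g.eval t| ≤ w ^ (k + 1) / ((k + 1) * 2 ^ (k + 1))} with hZ
  have hZm : MeasurableSet Z := by
    exact measurableSet_Icc.inter
      (measurableSet_le g.continuous.abs.measurable measurable_const)
  -- On the sublevel set `Z` the integrand is at most `1`; off it `|Q'| ≥ l * σ = l * τ / w`, so the
  -- integrand is at most `w ^ 2 ≤ w`.
  have e3 : ∫ t in (0 : ℝ)..1, (l * τ) ^ 2 / ((derivative Q).eval t ^ 2 + (l * τ) ^ 2) ≤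
      w + 2 * w * k := by
    rw [intervalIntegral.integral_of_le zero_le_one, ← integral_Icc_eq_integral_Ioc]
    have hcont : Continuous fun t => (l * τ) ^ 2 / ((derivative Q).eval t ^ 2 + (l * τ) ^ 2) :=
      continuous_const.div (((derivative Q).continuous.pow 2).add continuous_const)
        fun t => by positivity
    have hZfin : volume Z ≠ ⊤ := ne_top_of_le_ne_top (by simp) hsub
    calc ∫ t in Set.Icc (0 : ℝ) 1, (l * τ) ^ 2 / ((derivative Q).eval t ^ 2 + (l * τ) ^ 2)
        ≤ ∫ t in Set.Icc (0 : ℝ) 1, (w + Z.indicator (fun _ => (1 : ℝ)) t) := by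
          refine setIntegral_mono_on hcont.integrableOn_Icc ?_ measurableSet_Icc ?_
          · refine (integrableOn_const (by simp)).add ?_
            exact ((integrable_indicator_iff hZm).2 (integrableOn_const hZfin)).integrableOn
          · intro t ht
            by_cases htZ : t ∈ Z
            · rw [Set.indicator_of_mem htZ]
              have : (l * τ) ^ 2 / ((derivative Q).eval t ^ 2 + (l * τ) ^ 2) ≤ 1 := by
                rw [div_le_one (by positivity)]; nlinarith [sq_nonneg ((derivative Q).eval t)]
              linarith
            · rw [Set.indicator_of_notMem htZ, add_zero]
              have h1 : σ < |g.eval t| := by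
                by_contra! hcon
                exact htZ ⟨ht, hcon.trans (le_of_eq (by rw [hσ, hc]; ring))⟩
              have h2 : |(derivative Q).eval t| = l * |g.eval t| := by
                rw [hg, eval_mul, eval_C, abs_mul, abs_of_pos (inv_pos.2 hl0), ← mul_assoc,
                  mul_inv_cancel₀ hl0.ne', one_mul]
              have h3 : (l * σ) ^ 2 ≤ (derivative Q).eval t ^ 2 := by
                rw [← sq_abs ((derivative Q).eval t), h2]
                gcongr
              rw [div_le_iff₀ (by positivity)]
              calc (l * τ) ^ 2 = w * w * (l * σ) ^ 2 := by rw [hτ]; ring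
                _ ≤ w * 1 * ((derivative Q).eval t ^ 2 + (l * τ) ^ 2) := by
                  gcongr; nlinarith [sq_nonneg (l * τ)]
                _ = _ := by ring
      _ = w + volume.real Z := by
          rw [integral_add (integrable_const w)
            ((integrable_indicator_iff hZm).2 (integrableOn_const hZfin)).integrableOn]
          congr 1
          · simp
          · rw [integral_indicator hZm, Measure.restrict_restrict hZm,
              Set.inter_eq_left.2 (Set.sep_subset _ _), setIntegral_const, smul_eq_mul, mul_one]
      _ ≤ w + 2 * w * k := by
          gcongr
          exact ENNReal.toReal_le_of_le_ofReal (by positivity) hsub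
  calc _ ≤ w / c ^ 2 + G * (w / c ^ 2) + (w + 2 * w * k) := by gcongr
    _ = _ := by ring

/-! ### A dominating measure with decaying characteristic function -/

/-- Exponents of the nonconstant monomials in `d` variables with all exponents at most `p`. -/
abbrev MonomialIndex (d p : ℕ) : Type := {a : Fin d → Fin (p + 1) // a ≠ 0}

/-- The vector of all nonconstant monomials with exponents at most `p`. -/
noncomputable def monomialMap (d p : ℕ) (x : EuclideanSpace ℝ (Fin d)) :
    EuclideanSpace ℝ (MonomialIndex d p) :=
  WithLp.toLp 2 fun a => ∏ i, x i ^ (a.1 i : ℕ)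

theorem continuous_monomialMap (d p : ℕ) : Continuous (monomialMap d p) := by
  unfold monomialMap
  fun_prop

/-- The curve `t ↦ (t ^ q ^ i)ᵢ` with `q = p + 1`. -/
noncomputable def kroneckerCurve (d p : ℕ) (t : ℝ) : EuclideanSpace ℝ (Fin d) :=
  WithLp.toLp 2 fun i => t ^ (p + 1) ^ (i : ℕ)

theorem continuous_kroneckerCurve (d p : ℕ) : Continuous (kroneckerCurve d p) := by
  unfold kroneckerCurve
  fun_prop

theorem norm_kroneckerCurve_le {d p : ℕ} {t : ℝ} (ht : t ∈ Set.Icc (0 : ℝ) 1) :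
    ‖kroneckerCurve d p t‖ ≤ d := by
  rw [EuclideanSpace.norm_eq]
  refine Real.sqrt_le_iff.2 ⟨by positivity, ?_⟩
  have : ∀ i ∈ Finset.univ, ‖kroneckerCurve d p t i‖ ^ 2 ≤ 1 := fun i _ => by
    simp only [kroneckerCurve, Real.norm_eq_abs, sq_abs, ← pow_mul]
    exact pow_le_one₀ ht.1 ht.2
  refine (Finset.sum_le_sum this).trans ?_
  simp
  rcases Nat.eq_zero_or_pos d with rfl | h
  · simp
  · exact_mod_cast Nat.le_self_pow two_ne_zero d

section CurvePolynomial

open Polynomial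

/-- The monomial with exponent `a` restricted to the translate of the Kronecker curve by `u`. -/
noncomputable def curveMonomial {d p : ℕ} (u : EuclideanSpace ℝ (Fin d))
    (a : Fin d → Fin (p + 1)) : ℝ[X] :=
  ∏ i : Fin d, (X ^ (p + 1) ^ (i : ℕ) + C (u i)) ^ (a i : ℕ)

theorem monic_curveMonomial {d p : ℕ} (u : EuclideanSpace ℝ (Fin d)) (a : Fin d → Fin (p + 1)) :
    (curveMonomial u a).Monic :=
  monic_prod_of_monic _ _ fun _ _ => (monic_X_pow_add_C _ (pow_ne_zero _ p.succ_ne_zero)).pow _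

/-- The exponents `a i ≤ p` are the base `p + 1` digits of the degree. Hence different monomials
have different degrees along the curve, whatever the translation `u`. -/
theorem natDegree_curveMonomial {d p : ℕ} (u : EuclideanSpace ℝ (Fin d))
    (a : Fin d → Fin (p + 1)) :
    (curveMonomial u a).natDegree = (finFunctionFinEquiv a : ℕ) := by
  rw [curveMonomial, natDegree_prod_of_monic _ _
    fun _ _ => (monic_X_pow_add_C _ (pow_ne_zero _ p.succ_ne_zero)).pow _, finFunctionFinEquiv_apply]
  refine Finset.sum_congr rfl fun i _ => ?_
  rw [(monic_X_pow_add_C _ (pow_ne_zero _ p.succ_ne_zero)).natDegree_pow, natDegree_X_pow_add_C]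

/-- The linear combination of monomials with coefficients `ξ`, restricted to the translate of the
Kronecker curve by `u`. -/
noncomputable def curvePolynomial {d p : ℕ} (u : EuclideanSpace ℝ (Fin d))
    (ξ : EuclideanSpace ℝ (MonomialIndex d p)) : ℝ[X] :=
  ∑ a, C (ξ a) * curveMonomial u a.1

theorem eval_curvePolynomial {d p : ℕ} (u : EuclideanSpace ℝ (Fin d))
    (ξ : EuclideanSpace ℝ (MonomialIndex d p)) (t : ℝ) :
    (curvePolynomial u ξ).eval t = inner ℝ ξ (monomialMap d p (u + kroneckerCurve d p t)) := by
  simp only [curvePolynomial, curveMonomial, monomialMap, kroneckerCurve, eval_finsetSum, eval_mul,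
    eval_C, eval_prod, eval_pow, eval_add, eval_X, PiLp.inner_apply, RCLike.inner_apply,
    conj_trivial, PiLp.add_apply]
  refine Finset.sum_congr rfl fun a _ => ?_
  rw [mul_comm]
  congr 1
  refine Finset.prod_congr rfl fun i _ => ?_
  rw [add_comm]

theorem natDegree_curvePolynomial_le {d p : ℕ} (u : EuclideanSpace ℝ (Fin d))
    (ξ : EuclideanSpace ℝ (MonomialIndex d p)) :
    (curvePolynomial u ξ).natDegree ≤ (p + 1) ^ d := by
  refine natDegree_sum_le_of_forall_le _ _ fun a _ => (natDegree_C_mul_le _ _).trans ?_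
  rw [natDegree_curveMonomial]
  exact (finFunctionFinEquiv a.1).2.le

/-- Among the monomials present in `ξ`, the one of highest degree along the curve is monic and
cannot be cancelled. Its degree is positive because the exponent `0` is excluded. -/
theorem exists_coeff_curvePolynomial_ne_zero {d p : ℕ} (u : EuclideanSpace ℝ (Fin d))
    {ξ : EuclideanSpace ℝ (MonomialIndex d p)} (hξ : ξ ≠ 0) :
    ∃ n < (p + 1) ^ d, (curvePolynomial u ξ).coeff (n + 1) ≠ 0 := by
  classical
  have hne : (Finset.univ.filter fun a => ξ a ≠ 0).Nonempty := by
    by_contra hcon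
    apply hξ
    ext a
    by_contra ha
    exact hcon ⟨a, by simpa using ha⟩
  obtain ⟨a, ha, hmax⟩ := Finset.exists_max_image _
    (fun a : MonomialIndex d p => (finFunctionFinEquiv a.1 : ℕ)) hne
  simp only [Finset.mem_filter, Finset.mem_univ, true_and] at ha hmax
  have hco : (curvePolynomial u ξ).coeff (finFunctionFinEquiv a.1 : ℕ) = ξ a := by
    rw [curvePolynomial, finsetSum_coeff, Finset.sum_eq_single a]
    · have := (monic_curveMonomial u a.1).coeff_natDegree
      rw [natDegree_curveMonomial] at this
      rw [coeff_C_mul, this, mul_one]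
    · intro b _ hb
      rw [coeff_C_mul]
      by_cases hb0 : ξ b = 0
      · simp [hb0]
      · rw [coeff_eq_zero_of_natDegree_lt, mul_zero]
        rw [natDegree_curveMonomial]
        refine lt_of_le_of_ne (hmax b hb0) fun h => hb ?_
        exact Subtype.ext (finFunctionFinEquiv.injective (Fin.ext h))
    · simp
  have hpos : (finFunctionFinEquiv a.1 : ℕ) ≠ 0 := by
    intro h
    rw [finFunctionFinEquiv_apply, Finset.sum_eq_zero_iff] at h
    apply a.2
    funext i
    have := h i (Finset.mem_univ _)
    have h2 : ((p + 1) ^ (i : ℕ)) ≠ 0 := by positivity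
    have h3 := (Nat.mul_eq_zero.1 this).resolve_right h2
    exact Fin.ext (by simpa using h3)
  refine ⟨(finFunctionFinEquiv a.1 : ℕ) - 1, ?_, ?_⟩
  · have := (finFunctionFinEquiv a.1).2
    omega
  · rw [Nat.sub_add_cancel (Nat.one_le_iff_ne_zero.2 hpos), hco]
    exact ha

theorem continuous_coeff_finsetProd {ι Y : Type*} [TopologicalSpace Y] (s : Finset ι)
    (f : ι → Y → ℝ[X]) (hf : ∀ i ∈ s, ∀ n, Continuous fun y => (f i y).coeff n) (n : ℕ) :
    Continuous fun y => (∏ i ∈ s, f i y).coeff n := by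
  classical
  induction s using Finset.induction_on generalizing n with
  | empty => simpa using continuous_const
  | insert i s hi ih =>
    simp only [Finset.prod_insert hi, coeff_mul]
    refine continuous_finsetSum _ fun x _ => ?_
    exact (hf i (Finset.mem_insert_self _ _) _).mul
      (ih (fun j hj => hf j (Finset.mem_insert_of_mem hj)) _)

theorem continuous_coeff_curvePolynomial (d p n : ℕ) :
    Continuous fun y : EuclideanSpace ℝ (Fin d) × EuclideanSpace ℝ (MonomialIndex d p) =>
      (curvePolynomial y.1 y.2).coeff n := by
  simp only [curvePolynomial, finsetSum_coeff, coeff_C_mul]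
  refine continuous_finsetSum _ fun a _ => ?_
  refine Continuous.mul (by fun_prop) ?_
  refine continuous_coeff_finsetProd _ _ (fun i _ n => ?_) n
  have := continuous_coeff_finsetProd (Finset.range (a.1 i : ℕ))
    (fun _ (y : EuclideanSpace ℝ (Fin d) × EuclideanSpace ℝ (MonomialIndex d p)) =>
      (X ^ (p + 1) ^ (i : ℕ) + C (y.1 i) : ℝ[X])) (fun _ _ m => by
        simp only [coeff_add, coeff_C]
        split_ifs <;> fun_prop) n
  simpa only [Finset.prod_const, Finset.card_range] using this

/-- Compactness of ball times unit sphere, then homogeneity in `ξ`. -/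
theorem exists_le_coeff_curvePolynomial (d p : ℕ) (R : ℝ) :
    ∃ c : ℝ, 0 < c ∧ c ≤ 1 ∧ ∀ (u : EuclideanSpace ℝ (Fin d)) (ξ : EuclideanSpace ℝ (MonomialIndex d p)),
      ‖u‖ ≤ R → ξ ≠ 0 → ∃ n, c * ‖ξ‖ ≤ |(curvePolynomial u ξ).coeff (n + 1)| := by
  set k := (p + 1) ^ d with hk
  have hk0 : 0 < k := by positivity
  set F : EuclideanSpace ℝ (Fin d) × EuclideanSpace ℝ (MonomialIndex d p) → ℝ :=
    fun y => ∑ n ∈ Finset.range k, |(curvePolynomial y.1 y.2).coeff (n + 1)| with hF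
  have hFc : Continuous F := continuous_finsetSum _ fun n _ =>
    (continuous_coeff_curvePolynomial d p (n + 1)).abs
  have hFpos : ∀ u ξ, ξ ≠ 0 → 0 < F (u, ξ) := by
    intro u ξ hξ
    obtain ⟨n, hn, hn'⟩ := exists_coeff_curvePolynomial_ne_zero u hξ
    exact Finset.sum_pos' (fun _ _ => abs_nonneg _) ⟨n, by simpa using hn, abs_pos.2 hn'⟩
  have hK : IsCompact (Metric.closedBall (0 : EuclideanSpace ℝ (Fin d)) R ×ˢ
      Metric.sphere (0 : EuclideanSpace ℝ (MonomialIndex d p)) 1) :=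
    (isCompact_closedBall _ _).prod (isCompact_sphere _ _)
  obtain ⟨c, hc, hcF⟩ : ∃ c : ℝ, 0 < c ∧ ∀ u ξ, ‖u‖ ≤ R → ‖ξ‖ = 1 → c ≤ F (u, ξ) := by
    -- The product is empty for `R < 0`, and also when there are no nonconstant monomials, as for `p
    -- = 0`.
    rcases Set.eq_empty_or_nonempty (Metric.closedBall (0 : EuclideanSpace ℝ (Fin d)) R ×ˢ
      Metric.sphere (0 : EuclideanSpace ℝ (MonomialIndex d p)) 1) with h | h
    · refine ⟨1, one_pos, fun u ξ hu hξ => ?_⟩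
      have : (u, ξ) ∈ (∅ : Set _) := h ▸ (by simp [hu, hξ])
      exact absurd this (Set.notMem_empty _)
    · obtain ⟨y, hy, hmin⟩ := hK.exists_isMinOn h hFc.continuousOn
      refine ⟨F y, hFpos _ _ ?_, fun u ξ hu hξ => hmin (by simp [hu, hξ])⟩
      have := hy.2
      rintro h0
      simp [h0] at this
  refine ⟨min 1 (c / k), by positivity, min_le_left _ _, fun u ξ hu hξ => ?_⟩
  have hξ0 : 0 < ‖ξ‖ := norm_pos_iff.2 hξ
  have h1 := hcF u (‖ξ‖⁻¹ • ξ) hu (by rw [norm_smul, norm_inv, norm_norm, inv_mul_cancel₀ hξ0.ne'])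
  have hhom : ∀ n, (curvePolynomial u (‖ξ‖⁻¹ • ξ)).coeff n =
      ‖ξ‖⁻¹ * (curvePolynomial u ξ).coeff n := by
    intro n
    simp only [curvePolynomial, finsetSum_coeff, coeff_C_mul, Finset.mul_sum, PiLp.smul_apply,
      smul_eq_mul, mul_assoc]
  by_contra! hcon
  have h2 : F (u, ‖ξ‖⁻¹ • ξ) < c := by
    calc F (u, ‖ξ‖⁻¹ • ξ) < ∑ n ∈ Finset.range k, c / k := by
          refine Finset.sum_lt_sum_of_nonempty ⟨0, by simpa using hk0⟩ fun n _ => ?_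
          simp only [hhom, abs_mul, abs_inv, abs_norm]
          rw [inv_mul_lt_iff₀ hξ0, mul_comm]
          refine (hcon n).trans_le ?_
          gcongr
          exact min_le_right _ _
      _ = c := by simp; field_simp
  linarith

/-- `μ₀` is Lebesgue measure on the ball of radius `R + d`, convolved with the image of `[0, 1]`
under the Kronecker curve. The curve has norm at most `d`, so each of its translations of the larger
ball still covers the ball of radius `R`, which gives domination. For the decay, integrate over the
curve parameter with the translation fixed: the phase is a polynomial of bounded degree with a
nonconstant coefficient of order `‖ξ‖`. -/
theorem exists_dominating_measure (d p : ℕ) (R : ℝ) :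
    ∃ μ₀ : Measure (EuclideanSpace ℝ (Fin d)), IsFiniteMeasure μ₀ ∧
      volume.restrict (Metric.closedBall 0 R) ≤ μ₀ ∧ ∃ C δ : ℝ, 0 < C ∧ 0 < δ ∧
        ∀ ξ : EuclideanSpace ℝ (MonomialIndex d p),
          ‖∫ x, Complex.exp (Complex.I * (inner ℝ ξ (monomialMap d p x) : ℝ)) ∂μ₀‖ ≤
            C * (1 + ‖ξ‖) ^ (-δ) := by
  set V := volume.restrict (Metric.closedBall (0 : EuclideanSpace ℝ (Fin d)) (R + d)) with hV
  set T := volume.restrict (Set.Icc (0 : ℝ) 1) with hT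
  have : IsFiniteMeasure V := ⟨by
    rw [hV, Measure.restrict_apply_univ]; exact measure_closedBall_lt_top⟩
  have hcont : Continuous fun y : EuclideanSpace ℝ (Fin d) × ℝ => y.1 + kroneckerCurve d p y.2 :=
    continuous_fst.add ((continuous_kroneckerCurve d p).comp continuous_snd)
  set μ₀ := (V.prod T).map (fun y => y.1 + kroneckerCurve d p y.2) with hμ₀
  have : IsFiniteMeasure μ₀ := by rw [hμ₀]; infer_instance
  refine ⟨μ₀, inferInstance, ?_, ?_⟩
  · refine Measure.le_iff.2 fun S hS => ?_
    rw [hμ₀, Measure.map_apply hcont.measurable hS,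
      Measure.prod_apply_symm (hcont.measurable hS)]
    have h1 : ∀ t ∈ Set.Icc (0 : ℝ) 1, volume.restrict (Metric.closedBall 0 R) S ≤
        V ((fun u => (u, t)) ⁻¹' ((fun y => y.1 + kroneckerCurve d p y.2) ⁻¹' S)) := by
      intro t ht
      rw [hV, Measure.restrict_apply hS, Measure.restrict_apply
        ((show Continuous fun u => (u, t) by fun_prop).measurable (hcont.measurable hS)),
        ← measure_preimage_add_right volume (kroneckerCurve d p t)]
      refine measure_mono fun u hu => ⟨hu.1, ?_⟩
      have h2 := hu.2
      rw [mem_closedBall_zero_iff] at h2 ⊢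
      have h3 := norm_sub_le (u + kroneckerCurve d p t) (kroneckerCurve d p t)
      rw [add_sub_cancel_right] at h3
      exact h3.trans (add_le_add h2 (norm_kroneckerCurve_le ht))
    calc volume.restrict (Metric.closedBall 0 R) S
        = ∫⁻ t in Set.Icc (0 : ℝ) 1, volume.restrict (Metric.closedBall 0 R) S := by simp
      _ ≤ _ := setLIntegral_mono' measurableSet_Icc h1
  · obtain ⟨C, M, hC, hM, hosc⟩ := exists_norm_integral_exp_polynomial_le ((p + 1) ^ d)
    obtain ⟨c, hc, hc1, hcoeff⟩ := exists_le_coeff_curvePolynomial d p (R + d)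
    have hM' : (0 : ℝ) < M := by exact_mod_cast hM
    have hnorm1 : ∀ r : ℝ, ‖Complex.exp (Complex.I * r)‖ = 1 := fun r => by
      rw [mul_comm]; exact Complex.norm_exp_ofReal_mul_I _
    set A := V.real Set.univ * C * (c / 2) ^ (-(1 / M : ℝ)) with hA
    set A' := μ₀.real Set.univ * (1 + 1 / c) ^ (1 / M : ℝ) with hA'
    have hA0 : 0 ≤ A := by positivity
    have hA'0 : 0 ≤ A' := by positivity
    refine ⟨A + A' + 1, 1 / M, by positivity, by positivity, fun ξ => ?_⟩
    have hE0 : 0 ≤ (1 + ‖ξ‖) ^ (-(1 / M : ℝ)) := by positivity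
    by_cases hξ : 1 ≤ c * ‖ξ‖
    · have hξ0 : ξ ≠ 0 := by rintro rfl; simp at hξ; linarith
      have hξ1 : 1 ≤ ‖ξ‖ := by nlinarith [norm_nonneg ξ]
      -- The smallest `w` for which the coefficient bound `c * ‖ξ‖` meets the requirement `(1 / w) ^
      -- M`.
      set w := (c * ‖ξ‖) ^ (-(1 / M : ℝ)) with hw
      have hw0 : 0 < w := by positivity
      have hw1 : w ≤ 1 := Real.rpow_le_one_of_one_le_of_nonpos hξ (by
        rw [neg_nonpos]; positivity)
      have hwM : (1 / w) ^ M = c * ‖ξ‖ := by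
        rw [hw, Real.rpow_neg (by positivity), one_div, inv_inv, ← Real.rpow_natCast,
          ← Real.rpow_mul (by positivity), one_div_mul_cancel hM'.ne', Real.rpow_one]
      have hbound : ‖∫ x, Complex.exp (Complex.I * (inner ℝ ξ (monomialMap d p x) : ℝ)) ∂μ₀‖ ≤
          C * w * V.real Set.univ := by
        have hce : Continuous fun x =>
            Complex.exp (Complex.I * (inner ℝ ξ (monomialMap d p x) : ℝ)) := by
          have := continuous_monomialMap d p
          fun_prop
        rw [hμ₀, integral_map hcont.aemeasurable hce.aestronglyMeasurable, integral_prod]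
        · refine norm_integral_le_of_norm_le_const ?_
          refine (ae_restrict_iff' measurableSet_closedBall).2 (Filter.Eventually.of_forall ?_)
          intro u hu
          obtain ⟨n, hn⟩ := hcoeff u ξ (by simpa using hu) hξ0
          have := hosc w (curvePolynomial u ξ) n hw0 hw1 (natDegree_curvePolynomial_le u ξ)
            (by rw [hwM]; exact hn)
          rw [intervalIntegral.integral_of_le zero_le_one, ← integral_Icc_eq_integral_Ioc] at this
          simpa only [eval_curvePolynomial] using this
        · refine (integrable_const (1 : ℝ)).mono' (hce.comp hcont).aestronglyMeasurable
            (Filter.Eventually.of_forall fun y => (hnorm1 _).le)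
      refine hbound.trans ?_
      have hw2 : w ≤ (c / 2) ^ (-(1 / M : ℝ)) * (1 + ‖ξ‖) ^ (-(1 / M : ℝ)) := by
        rw [← Real.mul_rpow (by positivity) (by positivity)]
        refine Real.rpow_le_rpow_of_nonpos (by positivity) ?_ (by rw [neg_nonpos]; positivity)
        nlinarith
      calc C * w * V.real Set.univ
          ≤ C * ((c / 2) ^ (-(1 / M : ℝ)) * (1 + ‖ξ‖) ^ (-(1 / M : ℝ))) * V.real Set.univ := by
            gcongr
        _ = A * (1 + ‖ξ‖) ^ (-(1 / M : ℝ)) := by rw [hA]; ring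
        _ ≤ _ := by gcongr; linarith
    · have h1 : ‖ξ‖ ≤ 1 / c := by rw [le_div_iff₀ hc]; linarith
      have h2 : ‖∫ x, Complex.exp (Complex.I * (inner ℝ ξ (monomialMap d p x) : ℝ)) ∂μ₀‖ ≤
          1 * μ₀.real Set.univ :=
        norm_integral_le_of_norm_le_const (Filter.Eventually.of_forall fun x => (hnorm1 _).le)
      have h3 : 1 ≤ (1 + 1 / c) ^ (1 / M : ℝ) * (1 + ‖ξ‖) ^ (-(1 / M : ℝ)) := by
        rw [Real.rpow_neg (by positivity), ← div_eq_mul_inv, one_le_div (by positivity)]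
        gcongr
      calc _ ≤ μ₀.real Set.univ * 1 := by rw [mul_one, ← one_mul (μ₀.real _)]; exact h2
        _ ≤ μ₀.real Set.univ * ((1 + 1 / c) ^ (1 / M : ℝ) * (1 + ‖ξ‖) ^ (-(1 / M : ℝ))) := by
            gcongr
        _ = A' * (1 + ‖ξ‖) ^ (-(1 / M : ℝ)) := by rw [hA']; ring
        _ ≤ _ := by gcongr; linarith

end CurvePolynomial

/-! ### Characteristic functions under domination of measures -/

section CharAlong

variable {X E : Type*} [MeasurableSpace X] [NormedAddCommGroup E] [InnerProductSpace ℝ E]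
  [MeasurableSpace E] [BorelSpace E] [FiniteDimensional ℝ E]

/-- The characteristic function of the image of `μ` under `φ`. -/
noncomputable def charAlong (μ : Measure X) (φ : X → E) (ξ : E) : ℂ :=
  ∫ x, Complex.exp (Complex.I * (inner ℝ ξ (φ x) : ℝ)) ∂μ

theorem norm_exp_I_mul_ofReal' (r : ℝ) : ‖Complex.exp (Complex.I * r)‖ = 1 := by
  rw [mul_comm]; exact Complex.norm_exp_ofReal_mul_I _

theorem measurable_inner_comp {φ : X → E} (hφ : Measurable φ) (ξ : E) :
    Measurable fun x => (inner ℝ ξ (φ x) : ℝ) := by fun_prop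

theorem integrable_exp_inner (μ : Measure X) [IsFiniteMeasure μ] {φ : X → E} (hφ : Measurable φ)
    (ξ : E) : Integrable (fun x => Complex.exp (Complex.I * (inner ℝ ξ (φ x) : ℝ))) μ := by
  refine (integrable_const (1 : ℝ)).mono' ?_ (Filter.Eventually.of_forall fun x =>
    (norm_exp_I_mul_ofReal' _).le)
  exact (by fun_prop : Measurable fun x =>
    Complex.exp (Complex.I * (inner ℝ ξ (φ x) : ℝ))).aestronglyMeasurable

theorem norm_charAlong_le (μ : Measure X) (φ : X → E) [IsFiniteMeasure μ] (ξ : E) :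
    ‖charAlong μ φ ξ‖ ≤ μ.real Set.univ := by
  have := norm_integral_le_of_norm_le_const (μ := μ) (C := 1)
    (f := fun x => Complex.exp (Complex.I * (inner ℝ ξ (φ x) : ℝ)))
    (Filter.Eventually.of_forall fun x => (norm_exp_I_mul_ofReal' _).le)
  rwa [one_mul] at this

theorem continuous_charAlong (μ : Measure X) [IsFiniteMeasure μ] {φ : X → E} (hφ : Measurable φ) :
    Continuous (charAlong μ φ) := by
  refine continuous_of_dominated (bound := fun _ => 1) ?_ ?_ (integrable_const _) ?_
  · intro ξ; exact (integrable_exp_inner μ hφ ξ).aestronglyMeasurable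
  · intro ξ; exact Filter.Eventually.of_forall fun x => (norm_exp_I_mul_ofReal' _).le
  · exact Filter.Eventually.of_forall fun x => by fun_prop

theorem integrable_cos_inner (μ : Measure X) [IsFiniteMeasure μ] {φ : X → E} (hφ : Measurable φ)
    (ξ : E) : Integrable (fun x => Real.cos (inner ℝ ξ (φ x))) μ :=
  (integrable_const (1 : ℝ)).mono' (by fun_prop : Measurable _).aestronglyMeasurable
    (Filter.Eventually.of_forall fun _ => Real.abs_cos_le_one _)

theorem integrable_sin_inner (μ : Measure X) [IsFiniteMeasure μ] {φ : X → E} (hφ : Measurable φ)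
    (ξ : E) : Integrable (fun x => Real.sin (inner ℝ ξ (φ x))) μ :=
  (integrable_const (1 : ℝ)).mono' (by fun_prop : Measurable _).aestronglyMeasurable
    (Filter.Eventually.of_forall fun _ => Real.abs_sin_le_one _)

/-- Symmetrization. Writing the squared modulus as an integral over `μ.prod μ` makes domination
usable: integrals of nonnegative functions of a pair are monotone in `μ`. -/
theorem norm_charAlong_sq (μ : Measure X) [IsFiniteMeasure μ] {φ : X → E} (hφ : Measurable φ)
    (ξ : E) : ‖charAlong μ φ ξ‖ ^ 2 =
      ∫ z : X × X, Real.cos (inner ℝ ξ (φ z.1 - φ z.2)) ∂(μ.prod μ) := by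
  have h1 : charAlong μ φ ξ = ((∫ x, Real.cos (inner ℝ ξ (φ x)) ∂μ : ℝ) : ℂ) +
      ((∫ x, Real.sin (inner ℝ ξ (φ x)) ∂μ : ℝ) : ℂ) * Complex.I := by
    rw [← integral_complex_ofReal, ← integral_complex_ofReal, ← integral_mul_const, ← integral_add]
    · unfold charAlong
      refine integral_congr_ae (Filter.Eventually.of_forall fun x => ?_)
      simp only
      rw [mul_comm, Complex.exp_mul_I]
      simp
    · exact (integrable_cos_inner μ hφ ξ).ofReal
    · exact (integrable_sin_inner μ hφ ξ).ofReal.mul_const _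
  rw [h1, ← Complex.normSq_eq_norm_sq, Complex.normSq_add_mul_I]
  simp only [inner_sub_right, Real.cos_sub]
  rw [integral_add, integral_prod_mul (μ := μ) (ν := μ) (fun x => Real.cos (inner ℝ ξ (φ x)))
    (fun x => Real.cos (inner ℝ ξ (φ x))), integral_prod_mul (μ := μ) (ν := μ)
    (fun x => Real.sin (inner ℝ ξ (φ x))) (fun x => Real.sin (inner ℝ ξ (φ x))), sq, sq]
  · exact (integrable_cos_inner μ hφ ξ).mul_prod (integrable_cos_inner μ hφ ξ)
  · exact (integrable_sin_inner μ hφ ξ).mul_prod (integrable_sin_inner μ hφ ξ)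

/-- Integrable functions with nonnegative cosine transform. -/
def HasNonnegCosTransform (h : E → ℝ) : Prop :=
  Integrable h ∧ ∀ y : E, 0 ≤ ∫ ξ, h ξ * Real.cos (inner ℝ ξ y)

theorem integrable_norm_charAlong_sq_mul (μ : Measure X) [IsFiniteMeasure μ] {φ : X → E}
    (hφ : Measurable φ) {h : E → ℝ} (hh : Integrable h) :
    Integrable fun ξ => ‖charAlong μ φ ξ‖ ^ 2 * h ξ := by
  refine hh.bdd_mul (c := μ.real Set.univ ^ 2)
    ((continuous_charAlong μ hφ).norm.pow 2).aestronglyMeasurable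
    (Filter.Eventually.of_forall fun ξ => ?_)
  rw [Real.norm_of_nonneg (by positivity)]
  gcongr
  exact norm_charAlong_le μ φ ξ

/-- Fubini, symmetrization and the product formula for cosines: multiplying the weight by
`‖charAlong μ φ‖ ^ 2` averages translates of its cosine transform, and so preserves its
nonnegativity. -/
theorem integral_norm_charAlong_sq_mul (μ : Measure X) [IsFiniteMeasure μ] {φ : X → E}
    (hφ : Measurable φ) {h : E → ℝ} (hh : Integrable h) (y : E) :
    ∫ ξ, ‖charAlong μ φ ξ‖ ^ 2 * h ξ * Real.cos (inner ℝ ξ y) =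
      ∫ z : X × X, ((∫ ξ, h ξ * Real.cos (inner ℝ ξ (φ z.1 - φ z.2 + y))) +
        ∫ ξ, h ξ * Real.cos (inner ℝ ξ (φ z.1 - φ z.2 - y))) / 2 ∂(μ.prod μ) := by
  have hcosint : ∀ v : E, Integrable fun ξ : E => h ξ * Real.cos (inner ℝ ξ v) := fun v =>
    hh.mul_bdd (c := 1) (by fun_prop : Continuous fun ξ : E =>
      Real.cos (inner ℝ ξ v)).aestronglyMeasurable
      (Filter.Eventually.of_forall fun _ => Real.abs_cos_le_one _)
  calc ∫ ξ, ‖charAlong μ φ ξ‖ ^ 2 * h ξ * Real.cos (inner ℝ ξ y)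
      = ∫ ξ, ∫ z : X × X, h ξ * (Real.cos (inner ℝ ξ (φ z.1 - φ z.2)) *
          Real.cos (inner ℝ ξ y)) ∂(μ.prod μ) := by
        refine integral_congr_ae (Filter.Eventually.of_forall fun ξ => ?_)
        simp only
        rw [integral_const_mul, integral_mul_const, norm_charAlong_sq μ hφ]
        ring
    _ = ∫ z : X × X, (∫ ξ, h ξ * (Real.cos (inner ℝ ξ (φ z.1 - φ z.2)) *
          Real.cos (inner ℝ ξ y))) ∂(μ.prod μ) := by
        refine integral_integral_swap ?_
        have h1 : Integrable (fun q : E × (X × X) => h q.1) (volume.prod (μ.prod μ)) :=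
          hh.comp_fst _
        refine h1.mul_bdd (c := 1) ?_ (Filter.Eventually.of_forall fun q => ?_)
        · exact (by fun_prop : Measurable fun q : E × (X × X) =>
            Real.cos (inner ℝ q.1 (φ q.2.1 - φ q.2.2)) *
              Real.cos (inner ℝ q.1 y)).aestronglyMeasurable
        · rw [norm_mul]
          exact mul_le_one₀ (Real.abs_cos_le_one _) (norm_nonneg _) (Real.abs_cos_le_one _)
    _ = _ := by
        refine integral_congr_ae (Filter.Eventually.of_forall fun z => ?_)
        simp only
        rw [← integral_add (hcosint _) (hcosint _), ← integral_div]
        refine integral_congr_ae (Filter.Eventually.of_forall fun ξ => ?_)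
        simp only [inner_add_right, inner_sub_right, Real.cos_add, Real.cos_sub]
        ring

theorem HasNonnegCosTransform.norm_charAlong_sq_mul (μ : Measure X) [IsFiniteMeasure μ] {φ : X → E}
    (hφ : Measurable φ) {h : E → ℝ} (hh : HasNonnegCosTransform h) :
    HasNonnegCosTransform fun ξ => ‖charAlong μ φ ξ‖ ^ 2 * h ξ := by
  refine ⟨integrable_norm_charAlong_sq_mul μ hφ hh.1, fun y => ?_⟩
  rw [integral_norm_charAlong_sq_mul μ hφ hh.1]
  exact integral_nonneg fun z => div_nonneg (add_nonneg (hh.2 _) (hh.2 _)) zero_le_two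

/-- Both sides integrate the same function of the pair, a nonnegative cosine transform, over `μ.prod
μ ≤ μ₀.prod μ₀`. -/
theorem integral_norm_charAlong_sq_mul_mono {μ μ₀ : Measure X} [IsFiniteMeasure μ]
    [IsFiniteMeasure μ₀] (hμ : μ ≤ μ₀) {φ : X → E} (hφ : Measurable φ) {h : E → ℝ}
    (hh : HasNonnegCosTransform h) :
    ∫ ξ, ‖charAlong μ φ ξ‖ ^ 2 * h ξ ≤ ∫ ξ, ‖charAlong μ₀ φ ξ‖ ^ 2 * h ξ := by
  have e : ∀ (ν : Measure X) [IsFiniteMeasure ν], ∫ ξ, ‖charAlong ν φ ξ‖ ^ 2 * h ξ =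
      ∫ z : X × X, (∫ ξ, h ξ * Real.cos (inner ℝ ξ (φ z.1 - φ z.2))) ∂(ν.prod ν) := by
    intro ν _
    have := integral_norm_charAlong_sq_mul ν hφ hh.1 0
    simpa using this
  rw [e μ, e μ₀]
  refine integral_mono_measure (Measure.prod_mono hμ hμ)
    (Filter.Eventually.of_forall fun z => hh.2 _) ?_
  have hc : Continuous fun v : E => ∫ ξ, h ξ * Real.cos (inner ℝ ξ v) := by
    refine continuous_of_dominated (bound := fun ξ => ‖h ξ‖) ?_ ?_ hh.1.norm ?_
    · intro v
      exact hh.1.aestronglyMeasurable.mul (by fun_prop : Continuous fun ξ : E =>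
        Real.cos (inner ℝ ξ v)).aestronglyMeasurable
    · intro v
      refine Filter.Eventually.of_forall fun ξ => ?_
      rw [norm_mul]
      exact mul_le_of_le_one_right (norm_nonneg _) (Real.abs_cos_le_one _)
    · exact Filter.Eventually.of_forall fun ξ => by fun_prop
  refine (integrable_const (∫ ξ, ‖h ξ‖)).mono'
    (hc.measurable.comp (by fun_prop : Measurable fun z : X × X => φ z.1 - φ z.2)).aestronglyMeasurable
    (Filter.Eventually.of_forall fun z => ?_)
  refine (norm_integral_le_integral_norm _).trans ?_
  refine integral_mono_of_nonneg (Filter.Eventually.of_forall fun _ => norm_nonneg _) hh.1.norm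
    (Filter.Eventually.of_forall fun ξ => ?_)
  simp only
  rw [norm_mul]
  exact mul_le_of_le_one_right (norm_nonneg _) (Real.abs_cos_le_one _)

/-- Squared factors of `μ` are exchanged for those of `μ₀` one at a time; the remaining product
serves as the weight and keeps its nonnegative cosine transform. No pointwise comparison of the
characteristic functions is available. -/
theorem integral_norm_charAlong_pow_mul_mono {μ μ₀ : Measure X} [IsFiniteMeasure μ]
    [IsFiniteMeasure μ₀] (hμ : μ ≤ μ₀) {φ : X → E} (hφ : Measurable φ) (m : ℕ) {h : E → ℝ}
    (hh : HasNonnegCosTransform h) :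
    ∫ ξ, ‖charAlong μ φ ξ‖ ^ (2 * m) * h ξ ≤ ∫ ξ, ‖charAlong μ₀ φ ξ‖ ^ (2 * m) * h ξ := by
  have hpow : ∀ (k : ℕ), HasNonnegCosTransform fun ξ => ‖charAlong μ₀ φ ξ‖ ^ (2 * k) * h ξ := by
    intro k
    induction k with
    | zero => simpa using hh
    | succ k ih =>
      have := ih.norm_charAlong_sq_mul μ₀ hφ
      simpa only [← mul_assoc, ← pow_add, mul_add, mul_one, add_comm] using this
  -- `hpow` depends on `h`, so it is carried through the induction and must be supplied anew for the
  -- enlarged weight.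
  induction m generalizing h with
  | zero => simp
  | succ m ih =>
    calc ∫ ξ, ‖charAlong μ φ ξ‖ ^ (2 * (m + 1)) * h ξ
        = ∫ ξ, ‖charAlong μ φ ξ‖ ^ (2 * m) * (‖charAlong μ φ ξ‖ ^ 2 * h ξ) := by
          congr with ξ; ring
      _ ≤ ∫ ξ, ‖charAlong μ₀ φ ξ‖ ^ (2 * m) * (‖charAlong μ φ ξ‖ ^ 2 * h ξ) := by
          refine ih (hh.norm_charAlong_sq_mul μ hφ) fun k => ?_
          have := (hpow k).norm_charAlong_sq_mul μ hφ
          simpa only [mul_left_comm] using this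
      _ = ∫ ξ, ‖charAlong μ φ ξ‖ ^ 2 * (‖charAlong μ₀ φ ξ‖ ^ (2 * m) * h ξ) := by
          congr with ξ; ring
      _ ≤ ∫ ξ, ‖charAlong μ₀ φ ξ‖ ^ 2 * (‖charAlong μ₀ φ ξ‖ ^ (2 * m) * h ξ) :=
          integral_norm_charAlong_sq_mul_mono hμ hφ (hpow m)
      _ = _ := by congr with ξ; ring

theorem integral_gaussian_mul_exp_inner {b : ℝ} (hb : 0 < b) (y : E) :
    ∫ ξ : E, (Real.exp (-b * ‖ξ‖ ^ 2) : ℂ) * Complex.exp (Complex.I * (inner ℝ ξ y : ℝ)) =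
      (((Real.pi / b) ^ ((Module.finrank ℝ E : ℝ) / 2) * Real.exp (-(‖y‖ ^ 2 / (4 * b))) : ℝ) : ℂ) := by
  have := GaussianFourier.integral_cexp_neg_mul_sq_norm_add (V := E) (b := b) (by simpa using hb)
    Complex.I y
  push_cast
  rw [Complex.I_sq] at this
  convert this using 1
  · congr with ξ
    rw [Complex.exp_add, real_inner_comm]
  · congr 1
    · rw [Complex.ofReal_cpow (by positivity)]
      push_cast
      rfl
    · congr 1
      ring

theorem integrable_gaussian {b : ℝ} (hb : 0 < b) :
    Integrable fun ξ : E => Real.exp (-b * ‖ξ‖ ^ 2) := by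
  have := GaussianFourier.integrable_cexp_neg_mul_sq_norm_add (V := E) (b := b) (by simpa using hb)
    0 0
  refine this.re.congr (Filter.Eventually.of_forall fun ξ => ?_)
  simp only [zero_mul, add_zero]
  rw [← Complex.ofReal_pow, ← Complex.ofReal_neg, ← Complex.ofReal_mul, ← Complex.ofReal_exp]
  exact Complex.ofReal_re _

theorem hasNonnegCosTransform_gaussian {b : ℝ} (hb : 0 < b) :
    HasNonnegCosTransform fun ξ : E => Real.exp (-b * ‖ξ‖ ^ 2) := by
  refine ⟨integrable_gaussian hb, fun y => ?_⟩
  have h1 := congrArg Complex.re (integral_gaussian_mul_exp_inner hb y)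
  have hint : Integrable fun ξ : E =>
      (Real.exp (-b * ‖ξ‖ ^ 2) : ℂ) * Complex.exp (Complex.I * (inner ℝ ξ y : ℝ)) :=
    (integrable_gaussian hb).ofReal.mul_bdd (c := 1)
      (by fun_prop : Continuous _).aestronglyMeasurable
      (Filter.Eventually.of_forall fun ξ => (norm_exp_I_mul_ofReal' _).le)
  rw [Complex.ofReal_re, ← Complex.reCLM_apply, ← Complex.reCLM.integral_comp_comm hint] at h1
  have h2 : ∀ ξ : E, Complex.reCLM ((Real.exp (-b * ‖ξ‖ ^ 2) : ℂ) *
      Complex.exp (Complex.I * (inner ℝ ξ y : ℝ))) =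
      Real.exp (-b * ‖ξ‖ ^ 2) * Real.cos (inner ℝ ξ y) := by
    intro ξ
    rw [Complex.reCLM_apply, Complex.re_ofReal_mul, mul_comm Complex.I,
      Complex.exp_ofReal_mul_I_re]
  simp only [h2] at h1
  rw [h1]
  positivity

theorem norm_charAlong_neg (μ : Measure X) [IsFiniteMeasure μ] {φ : X → E} (hφ : Measurable φ)
    (ξ : E) : ‖charAlong μ φ (-ξ)‖ = ‖charAlong μ φ ξ‖ := by
  have : ‖charAlong μ φ (-ξ)‖ ^ 2 = ‖charAlong μ φ ξ‖ ^ 2 := by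
    simp only [norm_charAlong_sq μ hφ, inner_neg_left, Real.cos_neg]
  exact (sq_eq_sq₀ (norm_nonneg _) (norm_nonneg _)).1 this

/-- After symmetrization the integrand is the Fejér-type sum `∑ cos ((j - k) θ) = |∑ exp (i j θ)| ^
2 ≥ 0`, so domination applies. -/
theorem sum_norm_charAlong_sq_mono {μ μ₀ : Measure X} [IsFiniteMeasure μ]
    [IsFiniteMeasure μ₀] (hμ : μ ≤ μ₀) {φ : X → E} (hφ : Measurable φ) (K : ℕ) (ξ : E) :
    ∑ j ∈ Finset.range K, ∑ k ∈ Finset.range K, ‖charAlong μ φ (((j : ℝ) - k) • ξ)‖ ^ 2 ≤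
    ∑ j ∈ Finset.range K, ∑ k ∈ Finset.range K, ‖charAlong μ₀ φ (((j : ℝ) - k) • ξ)‖ ^ 2 := by
  set S : X × X → ℝ := fun z => ∑ j ∈ Finset.range K, ∑ k ∈ Finset.range K,
    Real.cos (inner ℝ (((j : ℝ) - k) • ξ) (φ z.1 - φ z.2)) with hS
  have hint : ∀ (ν : Measure X) [IsFiniteMeasure ν] (η : E),
      Integrable (fun z : X × X => Real.cos (inner ℝ η (φ z.1 - φ z.2))) (ν.prod ν) :=
    fun ν _ η => integrable_cos_inner (ν.prod ν)
      (by fun_prop : Measurable fun z : X × X => φ z.1 - φ z.2) η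
  have e : ∀ (ν : Measure X) [IsFiniteMeasure ν],
      ∑ j ∈ Finset.range K, ∑ k ∈ Finset.range K, ‖charAlong ν φ (((j : ℝ) - k) • ξ)‖ ^ 2 =
        ∫ z, S z ∂(ν.prod ν) := by
    intro ν _
    simp only [hS, norm_charAlong_sq ν hφ]
    rw [integral_finsetSum _ fun j _ => integrable_finsetSum _ fun k _ => hint ν _]
    refine Finset.sum_congr rfl fun j _ => ?_
    rw [integral_finsetSum _ fun k _ => hint ν _]
  rw [e μ, e μ₀]
  refine integral_mono_measure (Measure.prod_mono hμ hμ)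
    (Filter.Eventually.of_forall fun z => ?_)
    (integrable_finsetSum _ fun j _ => integrable_finsetSum _ fun k _ => hint μ₀ _)
  set θ := (inner ℝ ξ (φ z.1 - φ z.2) : ℝ) with hθ
  have : S z = (∑ j ∈ Finset.range K, Real.cos (j * θ)) ^ 2 +
      (∑ j ∈ Finset.range K, Real.sin (j * θ)) ^ 2 := by
    simp only [hS, sq, Finset.sum_mul_sum, ← Finset.sum_add_distrib, real_inner_smul_left, ← hθ,
      sub_mul, Real.cos_sub]
  rw [this]
  change (0 : ℝ) ≤ _
  positivity

theorem abs_sin_natCast_mul_le (k : ℕ) (x : ℝ) : |Real.sin (k * x)| ≤ k * |Real.sin x| := by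
  induction k with
  | zero => simp
  | succ k ih =>
    push_cast
    rw [add_mul, one_mul, Real.sin_add]
    refine (abs_add_le _ _).trans ?_
    rw [abs_mul, abs_mul, add_mul, one_mul]
    refine add_le_add ?_ ?_
    · exact (mul_le_of_le_one_right (abs_nonneg _) (Real.abs_cos_le_one _)).trans ih
    · exact mul_le_of_le_one_left (abs_nonneg _) (Real.abs_cos_le_one _)

theorem one_sub_cos_natCast_mul_le (k : ℕ) (x : ℝ) :
    1 - Real.cos (k * x) ≤ k ^ 2 * (1 - Real.cos x) := by
  have h : ∀ y : ℝ, 1 - Real.cos y = 2 * Real.sin (y / 2) ^ 2 := by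
    intro y
    have := Real.cos_two_mul (y / 2)
    rw [mul_div_cancel₀ _ (two_ne_zero)] at this
    nlinarith [Real.sin_sq_add_cos_sq (y / 2)]
  rw [h, h, mul_div_assoc]
  have h2 := pow_le_pow_left₀ (abs_nonneg _) (abs_sin_natCast_mul_le k (x / 2)) 2
  rw [mul_pow, sq_abs, sq_abs] at h2
  linarith

/-- Symmetrization reduces this to `1 - cos (k x) ≤ k ^ 2 (1 - cos x)`. It transports a gap below
modulus one from `k • ξ` back to `ξ`. -/
theorem one_sub_norm_charAlong_sq_smul_le (μ : Measure X) [IsProbabilityMeasure μ] {φ : X → E}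
    (hφ : Measurable φ) (k : ℕ) (ξ : E) :
    1 - ‖charAlong μ φ ((k : ℝ) • ξ)‖ ^ 2 ≤ k ^ 2 * (1 - ‖charAlong μ φ ξ‖ ^ 2) := by
  have hint : ∀ η : E, Integrable (fun z : X × X => Real.cos (inner ℝ η (φ z.1 - φ z.2)))
      (μ.prod μ) := fun η => integrable_cos_inner (μ.prod μ)
      (by fun_prop : Measurable fun z : X × X => φ z.1 - φ z.2) η
  have e : ∀ η : E, 1 - ‖charAlong μ φ η‖ ^ 2 =
      ∫ z : X × X, (1 - Real.cos (inner ℝ η (φ z.1 - φ z.2))) ∂(μ.prod μ) := by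
    intro η
    rw [integral_sub (integrable_const _) (hint η), norm_charAlong_sq μ hφ]
    simp
  rw [e, e, ← integral_const_mul]
  refine integral_mono ((integrable_const _).sub (hint _))
    (((integrable_const _).sub (hint _)).const_mul _) fun z => ?_
  simp only [real_inner_smul_left]
  exact one_sub_cos_natCast_mul_le k _

/-- A measure dominated by one with decaying characteristic function has characteristic function
uniformly bounded away from modulus one. -/
theorem exists_norm_charAlong_sq_le (μ₀ : Measure X) [IsFiniteMeasure μ₀] {φ : X → E}
    (hφ : Measurable φ) {R : ℝ} (hR1 : 1 ≤ R) (hR : ∀ ξ, R ≤ ‖ξ‖ → ‖charAlong μ₀ φ ξ‖ ≤ 1 / 2) :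
    ∃ κ : ℝ, 0 < κ ∧ κ ≤ 1 ∧ ∀ (μ : Measure X) [IsProbabilityMeasure μ], μ ≤ μ₀ → ∀ ξ,
      ‖charAlong μ φ ξ‖ ^ 2 ≤ 1 - κ * min 1 (‖ξ‖ ^ 2) := by
  set m := μ₀.real Set.univ with hm
  obtain ⟨K, hK⟩ := exists_nat_ge (max 1 (4 * m ^ 2))
  have hK1 : (1 : ℝ) ≤ K := (le_max_left _ _).trans hK
  have hKm : 4 * m ^ 2 ≤ K := (le_max_right _ _).trans hK
  have hKpos : 0 < K := by exact_mod_cast (zero_lt_one.trans_le hK1)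
  -- The product of the two losses below: `2 * K ^ 2` from the gap for `‖ξ‖ ≥ R`, and `(2 * R) ^ 2`
  -- from scaling a small `ξ` up to norm `R`.
  set κ : ℝ := 1 / (8 * R ^ 2 * K ^ 2) with hκ
  have hκ0 : 0 < κ := by positivity
  refine ⟨κ, hκ0, ?_, fun μ _ hμ => ?_⟩
  · rw [hκ, div_le_one (by positivity)]
    have h1 : 1 ≤ R ^ 2 := one_le_pow₀ hR1
    have h2 : 1 ≤ (K : ℝ) ^ 2 := one_le_pow₀ hK1
    nlinarith
  have hle1 : ∀ ξ, ‖charAlong μ φ ξ‖ ^ 2 ≤ 1 := fun ξ =>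
    pow_le_one₀ (norm_nonneg _) (by simpa using norm_charAlong_le μ φ ξ)
  have hlarge : ∀ ξ, R ≤ ‖ξ‖ → 1 / (2 * (K : ℝ) ^ 2) ≤ 1 - ‖charAlong μ φ ξ‖ ^ 2 := by
    intro ξ hξ
    -- Otherwise the double sum for `μ` exceeds `K ^ 2 / 2`. For `μ₀` the off-diagonal terms are at
    -- most `1 / 4` each, as `‖(j - k) • ξ‖ ≥ R`, and the diagonal contributes at most `K * m ^ 2 ≤
    -- K ^ 2 / 4` by the choice of `K`.
    obtain ⟨k, hkK, hk⟩ : ∃ k < K, ‖charAlong μ φ ((k : ℝ) • ξ)‖ ^ 2 ≤ 1 / 2 := by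
      by_contra! hcon
      have hsum := sum_norm_charAlong_sq_mono hμ hφ K ξ
      have hL : ∑ j ∈ Finset.range K, ∑ k ∈ Finset.range K, (1 / 2 : ℝ) <
          ∑ j ∈ Finset.range K, ∑ k ∈ Finset.range K, ‖charAlong μ φ (((j : ℝ) - k) • ξ)‖ ^ 2 := by
        have hne : (Finset.range K).Nonempty := ⟨0, by simpa using hKpos⟩
        refine Finset.sum_lt_sum_of_nonempty hne fun j hj =>
          Finset.sum_lt_sum_of_nonempty hne fun k hk => ?_
        rw [Finset.mem_range] at hj hk
        rcases le_total k j with h | h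
        · have := hcon (j - k) (by omega)
          rwa [Nat.cast_sub h] at this
        · have := hcon (k - j) (by omega)
          rw [Nat.cast_sub h] at this
          rwa [← neg_sub, neg_smul, norm_charAlong_neg μ hφ]
      have hU : ∑ j ∈ Finset.range K, ∑ k ∈ Finset.range K,
          ‖charAlong μ₀ φ (((j : ℝ) - k) • ξ)‖ ^ 2 ≤
          ∑ j ∈ Finset.range K, ∑ k ∈ Finset.range K,
            ((if j = k then m ^ 2 else 0) + (1 / 4 : ℝ)) := by
        refine Finset.sum_le_sum fun j _ => Finset.sum_le_sum fun k _ => ?_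
        split_ifs with hjk
        · have := pow_le_pow_left₀ (norm_nonneg _) (norm_charAlong_le μ₀ φ (((j : ℝ) - k) • ξ)) 2
          linarith
        · have h1 : (1 : ℝ) ≤ |(j : ℝ) - k| := by
            have : (1 : ℤ) ≤ |(j : ℤ) - k| := Int.one_le_abs (by omega)
            exact_mod_cast this
          have h2 := hR (((j : ℝ) - k) • ξ) (by
            rw [norm_smul, Real.norm_eq_abs]
            nlinarith [norm_nonneg ξ])
          have := pow_le_pow_left₀ (norm_nonneg _) h2 2
          linarith
      have hUe : ∑ j ∈ Finset.range K, ∑ k ∈ Finset.range K,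
            ((if j = k then m ^ 2 else 0) + (1 / 4 : ℝ)) = K * m ^ 2 + K * (K * (1 / 4)) := by
        simp only [Finset.sum_add_distrib, Finset.sum_ite_eq, Finset.mem_range, Finset.sum_const,
          Finset.card_range, nsmul_eq_mul]
        congr 1
        rw [Finset.sum_congr rfl fun j hj => if_pos (Finset.mem_range.1 hj)]
        simp
      have hLe : ∑ j ∈ Finset.range K, ∑ k ∈ Finset.range K, (1 / 2 : ℝ) = K * (K * (1 / 2)) := by
        simp
      rw [hLe] at hL
      rw [hUe] at hU
      nlinarith
    have h1 := one_sub_norm_charAlong_sq_smul_le μ hφ k ξ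
    have h2 : (k : ℝ) ^ 2 * (1 - ‖charAlong μ φ ξ‖ ^ 2) ≤
        K ^ 2 * (1 - ‖charAlong μ φ ξ‖ ^ 2) := by
      have := hle1 ξ
      have h3 : (0 : ℝ) ≤ 1 - ‖charAlong μ φ ξ‖ ^ 2 := by linarith
      gcongr
    rw [div_le_iff₀ (by positivity)]
    linarith
  intro ξ
  rcases le_or_gt R ‖ξ‖ with hξ | hξ
  · have h1 := hlarge ξ hξ
    have h2 : κ * min 1 (‖ξ‖ ^ 2) ≤ 1 / (2 * (K : ℝ) ^ 2) := by
      calc κ * min 1 (‖ξ‖ ^ 2) ≤ κ * 1 := by gcongr; exact min_le_left _ _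
        _ = 1 / (8 * R ^ 2 * K ^ 2) := by rw [mul_one]
        _ ≤ _ := by
          gcongr
          have : 1 ≤ R ^ 2 := one_le_pow₀ hR1
          linarith
    linarith
  · rcases eq_or_ne ξ 0 with rfl | hξ0
    · simpa using hle1 0
    have hn : 0 < ‖ξ‖ := norm_pos_iff.2 hξ0
    set k := ⌈R / ‖ξ‖⌉₊ with hk
    have hk1 : R / ‖ξ‖ ≤ k := Nat.le_ceil _
    have hk2 : (k : ℝ) ≤ 2 * R / ‖ξ‖ := by
      have h1 := (Nat.ceil_lt_add_one (show 0 ≤ R / ‖ξ‖ by positivity)).le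
      have h2 : 1 ≤ R / ‖ξ‖ := by rw [one_le_div hn]; exact hξ.le
      rw [mul_div_assoc]; linarith
    have h1 := one_sub_norm_charAlong_sq_smul_le μ hφ k ξ
    have h2 := hlarge ((k : ℝ) • ξ) (by
      rw [norm_smul, Real.norm_of_nonneg (by positivity)]
      rwa [div_le_iff₀ hn] at hk1)
    have h3 : (0 : ℝ) ≤ 1 - ‖charAlong μ φ ξ‖ ^ 2 := by linarith [hle1 ξ]
    have h4 : 1 / (2 * (K : ℝ) ^ 2) ≤ (2 * R / ‖ξ‖) ^ 2 * (1 - ‖charAlong μ φ ξ‖ ^ 2) :=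
      (h2.trans h1).trans (by gcongr)
    have h5 : κ * ‖ξ‖ ^ 2 ≤ 1 - ‖charAlong μ φ ξ‖ ^ 2 := by
      have h6 : (2 * R / ‖ξ‖) ^ 2 * (κ * ‖ξ‖ ^ 2) = 1 / (2 * (K : ℝ) ^ 2) := by
        rw [hκ]; field_simp; ring
      rw [← h6] at h4
      exact le_of_mul_le_mul_left h4 (by positivity)
    have h6 : κ * min 1 (‖ξ‖ ^ 2) ≤ κ * ‖ξ‖ ^ 2 := by gcongr; exact min_le_right _ _
    linarith

end CharAlong

/-! ### Uniform local limit lower bound -/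

theorem norm_pow_sub_pow_le_mul {x y : ℂ} {M : ℝ} (hx : ‖x‖ ≤ M) (hy : ‖y‖ ≤ M) (n : ℕ) :
    ‖x ^ (n + 1) - y ^ (n + 1)‖ ≤ (n + 1) * ‖x - y‖ * M ^ n := by
  have hM : 0 ≤ M := (norm_nonneg x).trans hx
  induction n with
  | zero => simp
  | succ n ih =>
    have e : x ^ (n + 1 + 1) - y ^ (n + 1 + 1) =
        x * (x ^ (n + 1) - y ^ (n + 1)) + (x - y) * y ^ (n + 1) := by ring
    rw [e]
    refine (norm_add_le _ _).trans ?_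
    rw [norm_mul, norm_mul, norm_pow y]
    calc ‖x‖ * ‖x ^ (n + 1) - y ^ (n + 1)‖ + ‖x - y‖ * ‖y‖ ^ (n + 1)
        ≤ M * ((n + 1) * ‖x - y‖ * M ^ n) + ‖x - y‖ * M ^ (n + 1) := by gcongr
      _ = _ := by push_cast; ring

/-- Comparison of `f` with the quadratic approximation `1 - q / 2` near the origin. -/
theorem quadratic_approx_bounds {κ A r : ℝ} (hκ : 0 < κ) (hκ1 : κ ≤ 1) (hA : 1 ≤ A)
    (hr : r = κ / (4 * A ^ 3)) {f : ℂ} {q x : ℝ} (hx : 0 ≤ x) (hxr : x ≤ r)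
    (h1 : ‖f‖ ^ 2 ≤ 1 - κ * x ^ 2) (hq : q ≤ A ^ 2 * x ^ 2)
    (h3 : ‖f - (1 - q / 2 : ℝ)‖ ≤ A ^ 3 * x ^ 3) :
    0 ≤ 1 - q / 2 ∧ ‖f‖ ≤ 1 - κ * x ^ 2 / 4 ∧ ‖((1 - q / 2 : ℝ) : ℂ)‖ ≤ 1 - κ * x ^ 2 / 4 := by
  have hA0 : 0 < A := by linarith
  have hA3 : 1 ≤ A ^ 3 := one_le_pow₀ hA
  have hrA : A ^ 3 * r = κ / 4 := by rw [hr]; field_simp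
  have hκx : 0 ≤ κ * x ^ 2 := by positivity
  -- The radius `r` is chosen so that the cubic error costs at most half of the gap `κ * x ^ 2 / 2`
  -- available for `‖f‖`.
  have hx3 : A ^ 3 * x ^ 3 ≤ κ * x ^ 2 / 4 := by
    calc A ^ 3 * x ^ 3 = A ^ 3 * x * x ^ 2 := by ring
      _ ≤ A ^ 3 * r * x ^ 2 := by gcongr
      _ = _ := by rw [hrA]; ring
  have hκx1 : κ * x ^ 2 ≤ 1 := by linarith [sq_nonneg ‖f‖]
  have hfle : ‖f‖ ≤ 1 - κ * x ^ 2 / 2 := by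
    refine (sq_le_sq₀ (norm_nonneg _) (by linarith)).1 (h1.trans ?_)
    have : (1 - κ * x ^ 2 / 2) ^ 2 = 1 - κ * x ^ 2 + (κ * x ^ 2 / 2) ^ 2 := by ring
    rw [this]
    linarith [sq_nonneg (κ * x ^ 2 / 2)]
  have hAx : A * x ≤ 1 := by
    have hAA : A ≤ A ^ 3 := le_self_pow₀ hA (by norm_num)
    calc A * x ≤ A ^ 3 * r := by gcongr
      _ ≤ 1 := by rw [hrA]; linarith
  refine ⟨?_, by linarith, ?_⟩
  · have : A ^ 2 * x ^ 2 ≤ 1 := by rw [← mul_pow]; exact pow_le_one₀ (by positivity) hAx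
    linarith
  · have := norm_sub_le f (f - (1 - q / 2 : ℝ))
    rw [sub_sub_cancel] at this
    linarith

/-- Lower bound for the real part of a power of a function that behaves like the characteristic
function of a centred random vector, near the origin. -/
theorem re_pow_lower_bound_near {κ A r : ℝ} (hκ : 0 < κ) (hκ1 : κ ≤ 1) (hA : 1 ≤ A)
    (hr : r = κ / (4 * A ^ 3)) {f : ℂ} {q x : ℝ} (hx : 0 ≤ x) (hxr : x ≤ r)
    (h1 : ‖f‖ ^ 2 ≤ 1 - κ * x ^ 2) (hq : q ≤ A ^ 2 * x ^ 2)
    (h3 : ‖f - (1 - q / 2 : ℝ)‖ ≤ A ^ 3 * x ^ 3) {k : ℕ} (hk : 1 ≤ k) :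
    (if x ≤ 1 / (A * √(k + 1 : ℕ)) then 1 / 2 else 0) - (k + 1 : ℕ) * A ^ 3 *
      (x ^ 3 * Real.exp (-(κ / 8 * √(k + 1 : ℕ) ^ 2) * x ^ 2)) ≤ (f ^ (k + 1)).re := by
  obtain ⟨ha0, hfM, haM⟩ := quadratic_approx_bounds hκ hκ1 hA hr hx hxr h1 hq h3
  have hA0 : 0 < A := by linarith
  have hn0 : (0 : ℝ) < (k + 1 : ℕ) := by positivity
  have hsn : √((k + 1 : ℕ) : ℝ) ^ 2 = (k + 1 : ℕ) := Real.sq_sqrt hn0.le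
  generalize ha : 1 - q / 2 = a at *
  have hM0 : 0 ≤ 1 - κ * x ^ 2 / 4 := (norm_nonneg _).trans hfM
  have hdiff := norm_pow_sub_pow_le_mul hfM haM k
  -- The telescoped difference leaves only `k` factors; `κ / 8` instead of `κ / 4` absorbs the
  -- missing one, since `k ≥ (k + 1) / 2`.
  have hMk : (1 - κ * x ^ 2 / 4) ^ k ≤ Real.exp (-(κ / 8 * √(k + 1 : ℕ) ^ 2) * x ^ 2) := by
    have : 1 - κ * x ^ 2 / 4 ≤ Real.exp (-(κ * x ^ 2 / 4)) := by
      have := Real.add_one_le_exp (-(κ * x ^ 2 / 4))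
      linarith
    calc (1 - κ * x ^ 2 / 4) ^ k ≤ Real.exp (-(κ * x ^ 2 / 4)) ^ k := by gcongr
      _ = Real.exp (k * (-(κ * x ^ 2 / 4))) := by rw [← Real.exp_nat_mul]
      _ ≤ _ := by
        rw [hsn]
        refine Real.exp_le_exp.2 ?_
        push_cast
        have hk : (1 : ℝ) ≤ k := by exact_mod_cast hk
        have h5 : 0 ≤ κ * x ^ 2 * (k - 1) := mul_nonneg (by positivity) (by linarith)
        linarith
  have hdiff2 : ‖f ^ (k + 1) - (a : ℂ) ^ (k + 1)‖ ≤ ((k + 1 : ℕ) : ℝ) * A ^ 3 *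
      (x ^ 3 * Real.exp (-(κ / 8 * √(k + 1 : ℕ) ^ 2) * x ^ 2)) := by
    refine hdiff.trans ?_
    calc ((k : ℝ) + 1) * ‖f - a‖ * (1 - κ * x ^ 2 / 4) ^ k ≤ ((k : ℝ) + 1) * (A ^ 3 * x ^ 3) *
          Real.exp (-(κ / 8 * √(k + 1 : ℕ) ^ 2) * x ^ 2) := by gcongr
      _ = _ := by push_cast; ring
  have hre2 : a ^ (k + 1) - ‖f ^ (k + 1) - (a : ℂ) ^ (k + 1)‖ ≤ (f ^ (k + 1)).re := by
    have h5 := (abs_le.1 (Complex.abs_re_le_norm (f ^ (k + 1) - (a : ℂ) ^ (k + 1)))).1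
    rw [Complex.sub_re, ← Complex.ofReal_pow, Complex.ofReal_re] at h5
    rw [← Complex.ofReal_pow]
    linarith
  -- Bernoulli's inequality at the scale `1 / √n`; beyond it only `a ≥ 0` is used.
  have hmain : (if x ≤ 1 / (A * √(k + 1 : ℕ)) then 1 / 2 else 0) ≤ a ^ (k + 1) := by
    split_ifs with hxs
    · have h6 : ((k + 1 : ℕ) : ℝ) * (A ^ 2 * x ^ 2) ≤ 1 := by
        rw [le_div_iff₀ (by positivity)] at hxs
        rw [← hsn]
        calc √(k + 1 : ℕ) ^ 2 * (A ^ 2 * x ^ 2) = (x * (A * √(k + 1 : ℕ))) ^ 2 := by ring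
          _ ≤ 1 := pow_le_one₀ (by positivity) hxs
      have h7 := mul_le_mul_of_nonneg_left hq hn0.le
      have h8 := one_add_mul_le_pow (a := a - 1) (by linarith) (k + 1)
      rw [add_sub_cancel] at h8
      have h9 : ((k + 1 : ℕ) : ℝ) * (a - 1) = -(((k + 1 : ℕ) : ℝ) * q / 2) := by rw [← ha]; ring
      rw [h9] at h8
      linarith
    · positivity
  linarith

/-- Lower bound for the real part of a power of a function that behaves like the characteristic
function of a centred random vector. -/
theorem re_pow_lower_bound {κ A r : ℝ} (hκ : 0 < κ) (hκ1 : κ ≤ 1) (hA : 1 ≤ A)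
    (hr : r = κ / (4 * A ^ 3)) {f : ℂ} {q x : ℝ} (hx : 0 ≤ x)
    (h1 : ‖f‖ ^ 2 ≤ 1 - κ * min 1 (x ^ 2)) (hq : q ≤ A ^ 2 * x ^ 2)
    (h3 : ‖f - (1 - q / 2 : ℝ)‖ ≤ A ^ 3 * x ^ 3) {n m : ℕ} (hn2 : 2 ≤ n) (hnm : 2 * m ≤ n)
    (hnr : 1 ≤ r * (A * √n)) :
    (if x ≤ 1 / (A * √n) then 1 / 2 else 0) - n * A ^ 3 * (x ^ 3 * Real.exp (-(κ / 8 * √n ^ 2) * x ^ 2))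
      - (1 - κ * r ^ 2 / 2) ^ (n - 2 * m) * ‖f‖ ^ (2 * m) ≤ (f ^ n).re := by
  have hA0 : 0 < A := by linarith
  have hr0 : 0 < r := by rw [hr]; positivity
  have hr1 : r ≤ 1 := by
    rw [hr, div_le_one (by positivity)]
    have : 1 ≤ A ^ 3 := one_le_pow₀ hA
    linarith
  have hr2 : r ^ 2 ≤ 1 := pow_le_one₀ hr0.le hr1
  have hs0 : 0 < √(n : ℝ) := Real.sqrt_pos.2 (by exact_mod_cast (by omega : 0 < n))
  have hκr : κ * r ^ 2 ≤ 1 := mul_le_one₀ hκ1 (by positivity) hr2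
  have hθ0 : 0 ≤ 1 - κ * r ^ 2 / 2 := by linarith
  have hball : 1 / (A * √n) ≤ r := by rw [div_le_iff₀ (by positivity)]; exact hnr
  have hre : -‖f ^ n‖ ≤ (f ^ n).re := (abs_le.1 (Complex.abs_re_le_norm _)).1
  have hE1 : 0 ≤ n * A ^ 3 * (x ^ 3 * Real.exp (-(κ / 8 * √n ^ 2) * x ^ 2)) := by positivity
  have hE2 : 0 ≤ (1 - κ * r ^ 2 / 2) ^ (n - 2 * m) * ‖f‖ ^ (2 * m) := by positivity
  rcases le_or_gt x r with hxr | hxr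
  · rw [min_eq_right (pow_le_one₀ hx (hxr.trans hr1))] at h1
    obtain ⟨k, rfl⟩ : ∃ k, n = k + 1 := ⟨n - 1, by omega⟩
    have := re_pow_lower_bound_near hκ hκ1 hA hr hx hxr h1 hq h3 (k := k) (by omega)
    linarith
  · rw [if_neg (by linarith)]
    have hmin : r ^ 2 ≤ min 1 (x ^ 2) := le_min hr2 (by gcongr)
    have hfθ : ‖f‖ ≤ 1 - κ * r ^ 2 / 2 := by
      refine (sq_le_sq₀ (norm_nonneg _) hθ0).1 (h1.trans ?_)
      have h4 : (1 - κ * r ^ 2 / 2) ^ 2 = 1 - κ * r ^ 2 + (κ * r ^ 2 / 2) ^ 2 := by ring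
      have h5 := mul_le_mul_of_nonneg_left hmin hκ.le
      rw [h4]
      linarith [sq_nonneg (κ * r ^ 2 / 2)]
    -- Away from the origin, `2 * m` factors are set aside for integrability and the others give
    -- exponential decay in `n`.
    have : ‖f ^ n‖ ≤ (1 - κ * r ^ 2 / 2) ^ (n - 2 * m) * ‖f‖ ^ (2 * m) := by
      rw [norm_pow]
      nth_rewrite 1 [← Nat.sub_add_cancel hnm]
      rw [pow_add]
      gcongr
    linarith

section LocalLimit

variable {E : Type*} [NormedAddCommGroup E] [InnerProductSpace ℝ E]
  [MeasurableSpace E] [BorelSpace E] [FiniteDimensional ℝ E]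

theorem integrable_norm_pow_three_mul_gaussian {a : ℝ} (ha : 0 < a) :
    Integrable fun ξ : E => ‖ξ‖ ^ 3 * Real.exp (-a * ‖ξ‖ ^ 2) := by
  refine ((integrable_gaussian (E := E) (half_pos ha)).const_mul (1 + 8 / a ^ 2)).mono'
    (by fun_prop : Continuous _).aestronglyMeasurable (Filter.Eventually.of_forall fun ξ => ?_)
  rw [Real.norm_of_nonneg (by positivity)]
  have h1 := Real.pow_div_factorial_le_exp (a / 2 * ‖ξ‖ ^ 2) (by positivity) 2
  have h2 : 1 ≤ Real.exp (a / 2 * ‖ξ‖ ^ 2) := Real.one_le_exp (by positivity)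
  have h3 : ‖ξ‖ ^ 3 ≤ 1 + ‖ξ‖ ^ 4 := by
    have h0 := norm_nonneg ξ
    nlinarith [sq_nonneg (‖ξ‖ ^ 2 - 1), sq_nonneg (‖ξ‖ ^ 2 - ‖ξ‖), sq_nonneg (‖ξ‖ - 1)]
  have h4 : ‖ξ‖ ^ 4 ≤ 8 / a ^ 2 * Real.exp (a / 2 * ‖ξ‖ ^ 2) := by
    calc ‖ξ‖ ^ 4 = 8 / a ^ 2 * ((a / 2 * ‖ξ‖ ^ 2) ^ 2 / (Nat.factorial 2 : ℕ)) := by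
          simp [Nat.factorial]; field_simp; ring
      _ ≤ _ := by gcongr
  calc ‖ξ‖ ^ 3 * Real.exp (-a * ‖ξ‖ ^ 2)
      ≤ ((1 + 8 / a ^ 2) * Real.exp (a / 2 * ‖ξ‖ ^ 2)) * Real.exp (-a * ‖ξ‖ ^ 2) := by
        gcongr; linarith
    _ = _ := by rw [mul_assoc, ← Real.exp_add]; ring_nf

theorem integral_norm_pow_three_mul_gaussian_scaled {a s : ℝ} (hs : 0 < s) :
    ∫ ξ : E, ‖ξ‖ ^ 3 * Real.exp (-(a * s ^ 2) * ‖ξ‖ ^ 2) =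
      (s ^ 3)⁻¹ * ((s ^ Module.finrank ℝ E)⁻¹ *
        ∫ ξ : E, ‖ξ‖ ^ 3 * Real.exp (-a * ‖ξ‖ ^ 2)) := by
  have := Measure.integral_comp_smul (volume : Measure E)
    (fun ξ : E => ‖ξ‖ ^ 3 * Real.exp (-a * ‖ξ‖ ^ 2)) s
  rw [abs_of_pos (by positivity), smul_eq_mul] at this
  rw [← this, ← integral_const_mul]
  congr with ξ
  rw [norm_smul, Real.norm_of_nonneg hs.le]
  field_simp

/-- Uniform local limit lower bound. -/
theorem exists_gaussian_integral_pow_lower_bound {κ A K : ℝ} (hκ : 0 < κ) (hκ1 : κ ≤ 1)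
    (hA : 1 ≤ A) (m : ℕ) :
    ∃ N : ℕ, ∀ n : ℕ, N ≤ n → ∃ c : ℝ, 0 < c ∧ ∀ (f : E → ℂ) (q : E → ℝ), Continuous f →
      (∀ ξ, ‖f ξ‖ ^ 2 ≤ 1 - κ * min 1 (‖ξ‖ ^ 2)) →
      (∀ ξ, q ξ ≤ A ^ 2 * ‖ξ‖ ^ 2) →
      (∀ ξ, ‖f ξ - (1 - q ξ / 2 : ℝ)‖ ≤ A ^ 3 * ‖ξ‖ ^ 3) →
      (∀ b : ℝ, 0 < b → ∫ ξ, ‖f ξ‖ ^ (2 * m) * Real.exp (-b * ‖ξ‖ ^ 2) ≤ K) →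
      ∀ b : ℝ, 0 < b → b ≤ 1 → c ≤ ∫ ξ, Real.exp (-b * ‖ξ‖ ^ 2) * (f ξ ^ n).re := by
  set D := Module.finrank ℝ E with hD
  set r := κ / (4 * A ^ 3) with hr
  set θ := 1 - κ * r ^ 2 / 2 with hθ
  set v := volume.real (Metric.ball (0 : E) 1) with hv
  set I := ∫ ξ : E, ‖ξ‖ ^ 3 * Real.exp (-(κ / 8) * ‖ξ‖ ^ 2) with hI
  have hA0 : 0 < A := by linarith
  have hr0 : 0 < r := by positivity
  have hr1 : r ≤ 1 := by
    rw [hr, div_le_one (by positivity)]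
    have : 1 ≤ A ^ 3 := one_le_pow₀ hA
    linarith
  have hθ0 : 0 < θ := by rw [hθ]; nlinarith
  have hθ1 : θ < 1 := by rw [hθ]; nlinarith [mul_pos hκ (pow_pos hr0 2)]
  have hv0 : 0 < v := ENNReal.toReal_pos (Metric.measure_ball_pos _ _ one_pos).ne'
    measure_ball_lt_top.ne
  have hI0 : 0 ≤ I := integral_nonneg fun ξ => by positivity
  set c₁ := 1 / 2 * Real.exp (-1) * ((A ^ D)⁻¹ * v) with hc₁
  have hc₁0 : 0 < c₁ := by positivity
  -- The ball of radius `1 / (A * √n)` yields the main term of order `n ^ (-D / 2)`; the cubic error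
  -- is smaller by a factor `√n`, and the far region is exponentially small. The factor `exp (-1)`
  -- in `c₁` bounds the Gaussian weight on that ball for all `b ≤ 1`, which makes `c` independent of
  -- `b`.
  set c : ℕ → ℝ := fun n => (√n ^ D)⁻¹ * (c₁ - A ^ 3 * I / √n) - θ ^ (n - 2 * m) * K with hc
  have hlim : Filter.Tendsto (fun n : ℕ => (√(n : ℝ) ^ D) * (θ ^ n * ((θ ^ (2 * m))⁻¹ * |K|)))
      Filter.atTop (nhds 0) := by
    have h1 := (tendsto_pow_const_mul_const_pow_of_abs_lt_one D
      (show |θ| < 1 by rw [abs_of_pos hθ0]; exact hθ1)).mul_const ((θ ^ (2 * m))⁻¹ * |K|)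
    rw [zero_mul] at h1
    refine squeeze_zero (fun n => by positivity) (fun n => ?_) h1
    rw [mul_assoc]
    gcongr
    rcases Nat.eq_zero_or_pos n with rfl | hn
    · simp
    · have h1n : (1 : ℝ) ≤ n := by exact_mod_cast hn
      exact Real.sqrt_le_iff.2 ⟨by positivity, by nlinarith⟩
  have hsq : Filter.Tendsto (fun n : ℕ => √(n : ℝ)) Filter.atTop Filter.atTop :=
    Real.tendsto_sqrt_atTop.comp tendsto_natCast_atTop_atTop
  have hlim2 : Filter.Tendsto (fun n : ℕ => A ^ 3 * I / √(n : ℝ)) Filter.atTop (nhds 0) :=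
    hsq.const_div_atTop _
  have hlim3 : Filter.Tendsto (fun n : ℕ => r * (A * √(n : ℝ))) Filter.atTop Filter.atTop :=
    (hsq.const_mul_atTop hA0).const_mul_atTop hr0
  have hev := ((hlim.eventually (gt_mem_nhds (show 0 < c₁ / 4 by positivity))).and
    (hlim2.eventually (gt_mem_nhds (show 0 < c₁ / 2 by positivity)))).and
    (hlim3.eventually_ge_atTop 1)
  obtain ⟨N, hN⟩ := Filter.eventually_atTop.1 hev
  refine ⟨max N (max 2 (2 * m)), fun n hn => ⟨c n, ?_, ?_⟩⟩
  · obtain ⟨⟨e1, e2⟩, -⟩ := hN n ((le_max_left _ _).trans hn)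
    have hn2 : 2 ≤ n := (le_max_left _ _).trans ((le_max_right _ _).trans hn)
    have hnm : 2 * m ≤ n := (le_max_right _ _).trans ((le_max_right _ _).trans hn)
    have hs0 : 0 < √(n : ℝ) := Real.sqrt_pos.2 (by exact_mod_cast (by omega : 0 < n))
    have e3 : θ ^ (n - 2 * m) * K < (√n ^ D)⁻¹ * (c₁ / 4) := by
      rw [inv_mul_eq_div, lt_div_iff₀ (by positivity)]
      refine lt_of_le_of_lt ?_ e1
      rw [pow_sub₀ θ hθ0.ne' hnm, mul_comm]
      calc √(n : ℝ) ^ D * (θ ^ n * (θ ^ (2 * m))⁻¹ * K)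
          ≤ √(n : ℝ) ^ D * (θ ^ n * (θ ^ (2 * m))⁻¹ * |K|) := by gcongr; exact le_abs_self K
        _ = _ := by ring
    have e4 : (√n ^ D)⁻¹ * (c₁ / 2) ≤ (√n ^ D)⁻¹ * (c₁ - A ^ 3 * I / √n) := by
      gcongr; linarith
    have e5 : 0 < (√(n : ℝ) ^ D)⁻¹ * (c₁ / 4) := by positivity
    simp only [hc]
    linarith
  · intro f q hf h1 hq h3 h2 b hb hb1
    obtain ⟨-, hnr⟩ := hN n ((le_max_left _ _).trans hn)
    have hn2 : 2 ≤ n := (le_max_left _ _).trans ((le_max_right _ _).trans hn)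
    have hnm : 2 * m ≤ n := (le_max_right _ _).trans ((le_max_right _ _).trans hn)
    have hs0 : 0 < √(n : ℝ) := Real.sqrt_pos.2 (by exact_mod_cast (by omega : 0 < n))
    have hn0 : (0 : ℝ) < n := by exact_mod_cast (by omega : 0 < n)
    have hsn : √(n : ℝ) ^ 2 = n := Real.sq_sqrt hn0.le
    have hf1 : ∀ ξ, ‖f ξ‖ ≤ 1 := by
      intro ξ
      have : 0 ≤ κ * min 1 (‖ξ‖ ^ 2) := by positivity
      exact (sq_le_one_iff₀ (norm_nonneg _)).1 (by linarith [h1 ξ])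
    set ρ := 1 / (A * √(n : ℝ)) with hρ
    have hρ0 : 0 < ρ := by positivity
    have hρ1 : ρ ≤ 1 := by
      rw [hρ, div_le_one (by positivity)]
      nlinarith [mul_pos hA0 hs0]
    have hg := integrable_gaussian (E := E) hb
    set S := Metric.closedBall (0 : E) ρ with hS
    have hSfin : volume S ≠ ⊤ := measure_closedBall_lt_top.ne
    have hSm : MeasurableSet S := measurableSet_closedBall
    set F₁ : E → ℝ := S.indicator fun _ => 1 / 2 * Real.exp (-1) with hF₁
    set F₂ : E → ℝ := fun ξ => n * A ^ 3 * (‖ξ‖ ^ 3 * Real.exp (-(κ / 8 * √n ^ 2) * ‖ξ‖ ^ 2)) with hF₂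
    set F₃ : E → ℝ := fun ξ => θ ^ (n - 2 * m) * (‖f ξ‖ ^ (2 * m) * Real.exp (-b * ‖ξ‖ ^ 2)) with hF₃
    have i1 : Integrable F₁ := (integrable_indicator_iff hSm).2 (integrableOn_const hSfin)
    have i2 : Integrable F₂ :=
      (integrable_norm_pow_three_mul_gaussian (by positivity)).const_mul _
    have i3 : Integrable F₃ := by
      refine (hg.bdd_mul (c := 1) (hf.norm.pow _).aestronglyMeasurable
        (Filter.Eventually.of_forall fun ξ => ?_)).const_mul _
      change ‖‖f ξ‖ ^ (2 * m)‖ ≤ 1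
      rw [norm_pow, norm_norm]
      exact pow_le_one₀ (norm_nonneg _) (hf1 ξ)
    have i4 : Integrable fun ξ => Real.exp (-b * ‖ξ‖ ^ 2) * (f ξ ^ n).re := by
      refine hg.mul_bdd (c := 1) (Complex.continuous_re.comp (hf.pow n)).aestronglyMeasurable
        (Filter.Eventually.of_forall fun ξ => ?_)
      refine (Complex.abs_re_le_norm _).trans ?_
      rw [norm_pow]
      exact pow_le_one₀ (norm_nonneg _) (hf1 ξ)
    have hpt : ∀ ξ, F₁ ξ - F₂ ξ - F₃ ξ ≤ Real.exp (-b * ‖ξ‖ ^ 2) * (f ξ ^ n).re := by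
      intro ξ
      have key := re_pow_lower_bound hκ hκ1 hA hr (norm_nonneg ξ) (h1 ξ) (hq ξ) (h3 ξ)
        hn2 hnm hnr
      have he0 : 0 < Real.exp (-b * ‖ξ‖ ^ 2) := Real.exp_pos _
      have he1 : Real.exp (-b * ‖ξ‖ ^ 2) ≤ 1 := Real.exp_le_one_iff.2 (by
        have := sq_nonneg ‖ξ‖; nlinarith)
      have hk := mul_le_mul_of_nonneg_left key he0.le
      refine le_trans ?_ hk
      rw [mul_sub, mul_sub]
      refine sub_le_sub (sub_le_sub ?_ ?_) ?_
      · by_cases hξ : ξ ∈ S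
        · have hξ' : ‖ξ‖ ≤ ρ := by simpa [hS] using hξ
          rw [hF₁, Set.indicator_of_mem hξ, if_pos hξ', mul_comm]
          gcongr
          have : ‖ξ‖ ^ 2 ≤ 1 := pow_le_one₀ (norm_nonneg _) (hξ'.trans hρ1)
          nlinarith [sq_nonneg ‖ξ‖]
        · rw [hF₁, Set.indicator_of_notMem hξ]
          split_ifs <;> positivity
      · exact mul_le_of_le_one_left (by positivity) he1
      · simp only [hF₃, ← hθ]
        exact le_of_eq (by ring)
    have hint := integral_mono ((i1.sub i2).sub i3) i4 hpt
    have j1 : ∫ ξ, F₁ ξ = (√n ^ D)⁻¹ * c₁ := by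
      rw [hF₁, integral_indicator hSm, setIntegral_const, smul_eq_mul, hS, Measure.real,
        Measure.addHaar_closedBall _ _ hρ0.le, ENNReal.toReal_mul, ENNReal.toReal_ofReal
        (by positivity), ← hD, hρ, hc₁, hv, Measure.real]
      rw [one_div, inv_pow, mul_pow, mul_inv]
      ring
    have j2 : ∫ ξ, F₂ ξ = (√n ^ D)⁻¹ * (A ^ 3 * I / √n) := by
      rw [hF₂, integral_const_mul, integral_norm_pow_three_mul_gaussian_scaled hs0, ← hD, ← hI]
      have : (n : ℝ) * (√(n : ℝ) ^ 3)⁻¹ = (√(n : ℝ))⁻¹ := by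
        calc (n : ℝ) * (√(n : ℝ) ^ 3)⁻¹ = √(n : ℝ) ^ 2 * (√(n : ℝ) ^ 3)⁻¹ := by rw [hsn]
          _ = _ := by field_simp
      calc _ = ((n : ℝ) * (√(n : ℝ) ^ 3)⁻¹) * (A ^ 3 * ((√(n : ℝ) ^ D)⁻¹ * I)) := by ring
        _ = _ := by rw [this]; ring
    have k1 : ∫ ξ, (F₁ - F₂ - F₃) ξ = (∫ ξ, F₁ ξ) - (∫ ξ, F₂ ξ) - ∫ ξ, F₃ ξ :=
      (integral_sub (i1.sub i2) i3).trans (by rw [← integral_sub i1 i2]; rfl)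
    have k3 : ∫ ξ, F₃ ξ =
        θ ^ (n - 2 * m) * ∫ ξ, ‖f ξ‖ ^ (2 * m) * Real.exp (-b * ‖ξ‖ ^ 2) := by
      rw [hF₃, integral_const_mul]
    have k4 := mul_le_mul_of_nonneg_left (h2 b hb) (show 0 ≤ θ ^ (n - 2 * m) by positivity)
    rw [k1, j1, j2, k3] at hint
    simp only [hc]
    linarith

end LocalLimit

/-! ### From positive density at zero to an exact zero -/

theorem tendsto_rpow_mul_exp_neg_div (D : ℝ) {η : ℝ} (hη : 0 < η) :
    Filter.Tendsto (fun b : ℝ => (Real.pi / b) ^ D * Real.exp (-(η ^ 2 / (4 * b))))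
      (nhdsWithin 0 (Set.Ioi 0)) (nhds 0) := by
  have h1 := tendsto_rpow_mul_exp_neg_mul_atTop_nhds_zero D (η ^ 2 / (4 * Real.pi)) (by positivity)
  have h2 : Filter.Tendsto (fun b : ℝ => Real.pi / b) (nhdsWithin 0 (Set.Ioi 0)) Filter.atTop := by
    simp only [div_eq_mul_inv]
    exact tendsto_inv_nhdsGT_zero.const_mul_atTop Real.pi_pos
  refine (h1.comp h2).congr fun b => ?_
  simp only [Function.comp_apply]
  congr 2
  field_simp

section ExactHit

open ProbabilityTheory

variable {X E : Type*} [MeasurableSpace X] [NormedAddCommGroup E] [InnerProductSpace ℝ E]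
  [MeasurableSpace E] [BorelSpace E] [FiniteDimensional ℝ E]

/-- The Gaussian kernel whose Fourier transform is `ξ ↦ exp (-b ‖ξ‖²)`, up to normalization. -/
noncomputable def gaussKernel (b : ℝ) (y : E) : ℝ :=
  (Real.pi / b) ^ ((Module.finrank ℝ E : ℝ) / 2) * Real.exp (-(‖y‖ ^ 2 / (4 * b)))

theorem gaussKernel_nonneg {b : ℝ} (hb : 0 < b) (y : E) : 0 ≤ gaussKernel b y := by
  unfold gaussKernel; positivity

theorem continuous_gaussKernel (b : ℝ) : Continuous (gaussKernel b : E → ℝ) := by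
  unfold gaussKernel; fun_prop

theorem gaussKernel_le {b : ℝ} (hb : 0 < b) {η : ℝ} (hη : 0 ≤ η) {y : E} (hy : η ≤ ‖y‖) :
    gaussKernel b y ≤ (Real.pi / b) ^ ((Module.finrank ℝ E : ℝ) / 2) *
      Real.exp (-(η ^ 2 / (4 * b))) := by
  unfold gaussKernel
  gcongr

theorem integrable_gaussKernel_comp {Ω : Type*} [MeasurableSpace Ω] (P : Measure Ω)
    [IsFiniteMeasure P] {S : Ω → E} (hS : Measurable S) {b : ℝ} (hb : 0 < b) :
    Integrable (fun ω => gaussKernel b (S ω)) P := by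
  refine (integrable_const ((Real.pi / b) ^ ((Module.finrank ℝ E : ℝ) / 2) *
      Real.exp (-((0 : ℝ) ^ 2 / (4 * b))))).mono'
    ((continuous_gaussKernel b).measurable.comp hS).aestronglyMeasurable
    (Filter.Eventually.of_forall fun ω => ?_)
  rw [Real.norm_of_nonneg (gaussKernel_nonneg hb _)]
  exact gaussKernel_le hb le_rfl (norm_nonneg _)

/-- Fourier inversion of the kernel and Fubini. The weight `H` is `1` for the smoothed density of
the sum at `0`, and the indicator of a bad pair for its error part. -/
theorem integral_mul_gaussKernel {Ω : Type*} [MeasurableSpace Ω] (P : Measure Ω)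
    [IsFiniteMeasure P] {S : Ω → E} (hS : Measurable S) {H : Ω → ℝ} (hH : Measurable H)
    (hH1 : ∀ ω, |H ω| ≤ 1) {b : ℝ} (hb : 0 < b) :
    ((∫ ω, H ω * gaussKernel b (S ω) ∂P : ℝ) : ℂ) =
      ∫ ξ : E, (Real.exp (-b * ‖ξ‖ ^ 2) : ℂ) *
        ∫ ω, (H ω : ℂ) * Complex.exp (Complex.I * (inner ℝ ξ (S ω) : ℝ)) ∂P := by
  calc ((∫ ω, H ω * gaussKernel b (S ω) ∂P : ℝ) : ℂ)
      = ∫ ω, (∫ ξ : E, (H ω : ℂ) * ((Real.exp (-b * ‖ξ‖ ^ 2) : ℂ) *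
          Complex.exp (Complex.I * (inner ℝ ξ (S ω) : ℝ)))) ∂P := by
        rw [← integral_complex_ofReal]
        refine integral_congr_ae (Filter.Eventually.of_forall fun ω => ?_)
        simp only
        rw [integral_const_mul, integral_gaussian_mul_exp_inner hb, gaussKernel,
          Complex.ofReal_mul]
    _ = ∫ ξ : E, (∫ ω, (H ω : ℂ) * ((Real.exp (-b * ‖ξ‖ ^ 2) : ℂ) *
          Complex.exp (Complex.I * (inner ℝ ξ (S ω) : ℝ))) ∂P) := by
        refine integral_integral_swap ?_
        have h1 : Integrable (fun q : Ω × E => Real.exp (-b * ‖q.2‖ ^ 2)) (P.prod volume) :=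
          (integrable_gaussian hb).comp_snd _
        refine h1.mono' ?_ (Filter.Eventually.of_forall fun q => ?_)
        · exact (by fun_prop : Measurable fun q : Ω × E => (H q.1 : ℂ) *
            ((Real.exp (-b * ‖q.2‖ ^ 2) : ℂ) *
              Complex.exp (Complex.I * (inner ℝ q.2 (S q.1) : ℝ)))).aestronglyMeasurable
        · simp only [Function.uncurry]
          rw [norm_mul, norm_mul, norm_exp_I_mul_ofReal', mul_one, Complex.norm_real,
            Complex.norm_real, Real.norm_of_nonneg (Real.exp_pos _).le]
          exact mul_le_of_le_one_left (Real.exp_pos _).le (hH1 _)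
    _ = _ := by
        refine integral_congr_ae (Filter.Eventually.of_forall fun ξ => ?_)
        simp only
        rw [← integral_const_mul]
        congr with ω
        ring

theorem exp_inner_sum {n : ℕ} (ψ : X → E) (ξ : E) (x : Fin n → X) (s : Finset (Fin n)) :
    Complex.exp (Complex.I * (inner ℝ ξ (∑ k ∈ s, ψ (x k)) : ℝ)) =
      ∏ k ∈ s, Complex.exp (Complex.I * (inner ℝ ξ (ψ (x k)) : ℝ)) := by
  rw [inner_sum, ← Complex.exp_sum]
  push_cast
  rw [Finset.mul_sum]

theorem integral_pi_prod_finset {n : ℕ} (μ : Measure X) [IsProbabilityMeasure μ] (s : Finset (Fin n))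
    (e : X → ℂ) :
    ∫ x : Fin n → X, ∏ k ∈ s, e (x k) ∂(Measure.pi fun _ => μ) = (∫ y, e y ∂μ) ^ s.card := by
  classical
  have h1 : ∀ x : Fin n → X, ∏ k ∈ s, e (x k) = ∏ k, (if k ∈ s then e else fun _ => 1) (x k) := by
    intro x
    rw [← Finset.prod_subset (Finset.subset_univ s)]
    · exact Finset.prod_congr rfl fun k hk => by rw [if_pos hk]
    · intro k _ hk; rw [if_neg hk]
  simp only [h1]
  rw [integral_fintype_prod_eq_prod (fun k => if k ∈ s then e else fun _ => 1),
    ← Finset.prod_subset (Finset.subset_univ s)]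
  · rw [Finset.prod_congr rfl fun k hk => by rw [if_pos hk], Finset.prod_const]
  · intro k _ hk; rw [if_neg hk]; simp

theorem integral_gaussKernel_sum {n : ℕ} (μ : Measure X) [IsProbabilityMeasure μ] {ψ : X → E}
    (hψ : Measurable ψ) {b : ℝ} (hb : 0 < b) :
    ∫ x : Fin n → X, gaussKernel b (∑ k, ψ (x k)) ∂(Measure.pi fun _ => μ) =
      ∫ ξ : E, Real.exp (-b * ‖ξ‖ ^ 2) * (charAlong μ ψ ξ ^ n).re := by
  have h := integral_mul_gaussKernel (Measure.pi fun _ : Fin n => μ)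
    (S := fun x => ∑ k, ψ (x k)) (by fun_prop) (H := fun _ => 1) measurable_const (by simp) hb
  simp only [one_mul, Complex.ofReal_one] at h
  have h2 : ∀ ξ : E, ∫ x : Fin n → X, Complex.exp (Complex.I * (inner ℝ ξ (∑ k, ψ (x k)) : ℝ))
      ∂(Measure.pi fun _ => μ) = charAlong μ ψ ξ ^ n := by
    intro ξ
    simp only [exp_inner_sum]
    rw [integral_pi_prod_finset μ Finset.univ
      (fun y => Complex.exp (Complex.I * (inner ℝ ξ (ψ y) : ℝ))), Finset.card_univ,
      Fintype.card_fin, charAlong]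
  simp only [h2] at h
  have hint : Integrable fun ξ : E =>
      (Real.exp (-b * ‖ξ‖ ^ 2) : ℂ) * charAlong μ ψ ξ ^ n := by
    refine (integrable_gaussian hb).ofReal.mul_bdd (c := 1)
      ((continuous_charAlong μ hψ).pow n).aestronglyMeasurable
      (Filter.Eventually.of_forall fun ξ => ?_)
    change ‖charAlong μ ψ ξ ^ n‖ ≤ 1
    rw [norm_pow]
    exact pow_le_one₀ (norm_nonneg _) (by simpa using norm_charAlong_le μ ψ ξ)
  have h3 := congrArg Complex.re h
  rw [Complex.ofReal_re, ← Complex.reCLM_apply, ← Complex.reCLM.integral_comp_comm hint] at h3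
  simpa only [Complex.reCLM_apply, Complex.re_ofReal_mul] using h3

theorem map_eval_pair_pi {n : ℕ} (μ : Measure X) [IsProbabilityMeasure μ] {k l : Fin n}
    (hkl : k ≠ l) :
    (Measure.pi fun _ : Fin n => μ).map (fun x => (x k, x l)) = μ.prod μ := by
  have hind : iIndepFun (fun (i : Fin n) (x : Fin n → X) => x i) (Measure.pi fun _ => μ) :=
    iIndepFun_pi (X := fun _ => id) fun _ => aemeasurable_id
  have h := (indepFun_iff_map_prod_eq_prod_map_map (measurable_pi_apply k).aemeasurable
    (measurable_pi_apply l).aemeasurable).1 (hind.indepFun hkl)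
  rw [h, (measurePreserving_eval (fun _ : Fin n => μ) k).map_eq,
    (measurePreserving_eval (fun _ : Fin n => μ) l).map_eq]

/-- The two marked coordinates are independent of the others: the pair contributes at most the
measure of `Z`, the remaining `n - 2` coordinates a power of the characteristic function. -/
theorem norm_integral_indicator_pair_exp_le {n : ℕ} (μ : Measure X) [IsProbabilityMeasure μ]
    {ψ : X → E} (hψ : Measurable ψ) {k l : Fin n} (hkl : k ≠ l) {Z : Set (X × X)}
    (hZ : MeasurableSet Z) (ξ : E) :
    ‖∫ x : Fin n → X, ((Z.indicator (fun _ => (1 : ℝ)) (x k, x l) : ℝ) : ℂ) *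
      Complex.exp (Complex.I * (inner ℝ ξ (∑ j, ψ (x j)) : ℝ)) ∂(Measure.pi fun _ => μ)‖ ≤
      (μ.prod μ).real Z * ‖charAlong μ ψ ξ‖ ^ (n - 2) := by
  classical
  set P := Measure.pi fun _ : Fin n => μ with hP
  set e : X → ℂ := fun y => Complex.exp (Complex.I * (inner ℝ ξ (ψ y) : ℝ)) with he
  have hem : Measurable e := by fun_prop
  have hne : ∀ y, ‖e y‖ = 1 := fun y => norm_exp_I_mul_ofReal' _
  set T : Finset (Fin n) := {k, l} with hT
  have hkT : k ∈ T := by simp [hT]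
  have hlT : l ∈ T := by simp [hT]
  have hind : iIndepFun (fun (i : Fin n) (x : Fin n → X) => x i) P :=
    iIndepFun_pi (X := fun _ => id) fun _ => aemeasurable_id
  have hind2 := hind.indepFun_finset T Tᶜ disjoint_compl_right fun i => measurable_pi_apply i
  set F : (T → X) → ℂ := fun y =>
    ((Z.indicator (fun _ => (1 : ℝ)) (y ⟨k, hkT⟩, y ⟨l, hlT⟩) : ℝ) : ℂ) * ∏ j, e (y j) with hF
  set G : ((Tᶜ : Finset (Fin n)) → X) → ℂ := fun y => ∏ j, e (y j) with hG
  have hZm : Measurable (Z.indicator fun _ => (1 : ℝ)) := measurable_const.indicator hZ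
  have hFm : Measurable F := by
    refine Measurable.mul ?_ (by fun_prop)
    exact Complex.measurable_ofReal.comp (hZm.comp (by fun_prop))
  have hGm : Measurable G := by fun_prop
  have hsplit : ∀ x : Fin n → X, ((Z.indicator (fun _ => (1 : ℝ)) (x k, x l) : ℝ) : ℂ) *
      Complex.exp (Complex.I * (inner ℝ ξ (∑ j, ψ (x j)) : ℝ)) =
      F (fun j => x j) * G (fun j => x j) := by
    intro x
    simp only [hF, hG]
    rw [exp_inner_sum, ← Finset.prod_mul_prod_compl T, mul_assoc,
      Finset.prod_coe_sort T (fun j => e (x j)), Finset.prod_coe_sort Tᶜ (fun j => e (x j))]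
  simp only [hsplit]
  have hind3 := hind2.comp hFm hGm
  have hmul := hind3.integral_fun_mul_eq_mul_integral
    (hFm.comp (by fun_prop : Measurable fun (x : Fin n → X) (j : T) => x j)).aestronglyMeasurable
    (hGm.comp (by fun_prop : Measurable fun (x : Fin n → X)
      (j : (Tᶜ : Finset (Fin n))) => x j)).aestronglyMeasurable
  refine (congrArg norm hmul).le.trans ?_
  rw [norm_mul]
  have hcard : (Tᶜ : Finset (Fin n)).card = n - 2 := by
    rw [Finset.card_compl, hT, Finset.card_pair hkl, Fintype.card_fin]
  have hGint : ∫ x, (G ∘ fun (x : Fin n → X) (j : (Tᶜ : Finset (Fin n))) => x j) x ∂P =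
      charAlong μ ψ ξ ^ (n - 2) := by
    have : ∀ x : Fin n → X, (G ∘ fun (x : Fin n → X) (j : (Tᶜ : Finset (Fin n))) => x j) x =
        ∏ j ∈ Tᶜ, e (x j) := fun x => Finset.prod_coe_sort Tᶜ (fun j => e (x j))
    simp only [this]
    rw [hP, integral_pi_prod_finset, hcard, charAlong]
  rw [hGint, norm_pow]
  refine mul_le_mul_of_nonneg_right ?_ (by positivity)
  refine (norm_integral_le_integral_norm _).trans (le_of_eq ?_)
  have hn : ∀ x : Fin n → X, ‖(F ∘ fun (x : Fin n → X) (j : T) => x j) x‖ =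
      Z.indicator (fun _ => (1 : ℝ)) (x k, x l) := by
    intro x
    simp only [Function.comp_apply, hF]
    simp only [norm_mul, norm_prod, hne, Finset.prod_const_one]
    rw [mul_one, Complex.norm_real, Real.norm_of_nonneg]
    exact Set.indicator_nonneg (fun _ _ => zero_le_one) _
  simp only [hn]
  rw [← integral_map (φ := fun x : Fin n → X => (x k, x l)) (by fun_prop)
    hZm.aestronglyMeasurable, map_eval_pair_pi μ hkl, integral_indicator_const _ hZ]
  simp

theorem integral_indicator_pair_gaussKernel_le {n : ℕ} (μ : Measure X) [IsProbabilityMeasure μ]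
    {ψ : X → E} (hψ : Measurable ψ) {k l : Fin n} (hkl : k ≠ l) {Z : Set (X × X)}
    (hZ : MeasurableSet Z) {b : ℝ} (hb : 0 < b) :
    ∫ x : Fin n → X, Z.indicator (fun _ => (1 : ℝ)) (x k, x l) *
      gaussKernel b (∑ j, ψ (x j)) ∂(Measure.pi fun _ => μ) ≤
      (μ.prod μ).real Z * ∫ ξ, ‖charAlong μ ψ ξ‖ ^ (n - 2) * Real.exp (-b * ‖ξ‖ ^ 2) := by
  have hZm : Measurable (Z.indicator fun _ => (1 : ℝ)) := measurable_const.indicator hZ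
  have h := integral_mul_gaussKernel (Measure.pi fun _ : Fin n => μ)
    (S := fun x => ∑ k, ψ (x k)) (by fun_prop)
    (H := fun x => Z.indicator (fun _ => (1 : ℝ)) (x k, x l))
    (hZm.comp (by fun_prop : Measurable fun x : Fin n → X => (x k, x l)))
    (fun x => by
      by_cases hx : (x k, x l) ∈ Z
      · simp [Set.indicator_of_mem hx]
      · simp [Set.indicator_of_notMem hx]) hb
  have h2 := congrArg norm h
  rw [Complex.norm_real] at h2
  refine (Real.le_norm_self _).trans (h2.le.trans ?_)
  rw [← integral_const_mul]
  have hint : Integrable fun ξ : E => ‖charAlong μ ψ ξ‖ ^ (n - 2) * Real.exp (-b * ‖ξ‖ ^ 2) := by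
    refine (integrable_gaussian hb).bdd_mul (c := 1)
      ((continuous_charAlong μ hψ).norm.pow _).aestronglyMeasurable
      (Filter.Eventually.of_forall fun ξ => ?_)
    change ‖‖charAlong μ ψ ξ‖ ^ (n - 2)‖ ≤ 1
    rw [norm_pow, norm_norm]
    exact pow_le_one₀ (norm_nonneg _) (by simpa using norm_charAlong_le μ ψ ξ)
  refine norm_integral_le_of_norm_le (hint.const_mul _) (Filter.Eventually.of_forall fun ξ => ?_)
  rw [norm_mul, Complex.norm_real, Real.norm_of_nonneg (Real.exp_pos _).le]
  have := norm_integral_indicator_pair_exp_le μ hψ hkl hZ ξ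
  calc Real.exp (-b * ‖ξ‖ ^ 2) * _ ≤ Real.exp (-b * ‖ξ‖ ^ 2) *
        ((μ.prod μ).real Z * ‖charAlong μ ψ ξ‖ ^ (n - 2)) := by gcongr
    _ = _ := by ring

/-- If the density at `0` of the sum of `n` independent copies of `ψ`, measured by Gaussian
kernels, stays positive, then `0` is attained as a sum of values of `ψ` at distinct points. -/
theorem exists_injective_sum_eq_zero [MetricSpace X] [ProperSpace X] [BorelSpace X] {n : ℕ}
    (hn : 2 ≤ n) (μ : Measure X) [IsProbabilityMeasure μ] [NullSingletonClass μ] {ψ : X → E}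
    (hψ : Continuous ψ) {B : Set X} (hB : MeasurableSet B) (hμB : μ Bᶜ = 0) {c G : ℝ} (hc : 0 < c)
    (h1 : ∀ b : ℝ, 0 < b → b ≤ 1 →
      c ≤ ∫ ξ, Real.exp (-b * ‖ξ‖ ^ 2) * (charAlong μ ψ ξ ^ n).re)
    (h2 : ∀ b : ℝ, 0 < b →
      ∫ ξ, ‖charAlong μ ψ ξ‖ ^ (n - 2) * Real.exp (-b * ‖ξ‖ ^ 2) ≤ G) :
    ∃ x : Fin n → X, Function.Injective x ∧ (∀ k, x k ∈ B) ∧ ∑ k, ψ (x k) = 0 := by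
  have : SecondCountableTopology X := secondCountable_of_proper
  have hG0 : 0 ≤ G := (integral_nonneg fun ξ => by positivity).trans (h2 1 one_pos)
  -- Small enough that all `n ^ 2` pairs together lose at most `c / 4`; the kernel on good tuples
  -- will lose less than `c / 2`.
  set τ : ℝ := c / (4 * ((n : ℝ) ^ 2 * (G + 1))) with hτ
  have hn0 : (0 : ℝ) < n := by exact_mod_cast (by omega : 0 < n)
  have hτ0 : 0 < τ := by positivity
  set W : Set (X × X) := (B ×ˢ B) \ Set.diagonal X with hW
  have hWm : MeasurableSet W := (hB.prod hB).diff isClosed_diagonal.measurableSet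
  have hWc : (μ.prod μ) Wᶜ = 0 := by
    have hsub : Wᶜ ⊆ (Bᶜ ×ˢ Set.univ) ∪ (Set.univ ×ˢ Bᶜ) ∪ Set.diagonal X := by
      intro z hz
      simp only [hW, Set.mem_compl_iff, Set.mem_sdiff, Set.mem_prod, Set.mem_union] at hz ⊢
      simp only [Set.mem_univ, and_true, true_and]
      tauto
    refine measure_mono_null hsub (measure_union_null (measure_union_null ?_ ?_) ?_)
    · rw [Measure.prod_prod, hμB, zero_mul]
    · rw [Measure.prod_prod, hμB, mul_zero]
    · rw [Measure.measure_prod_null isClosed_diagonal.measurableSet]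
      refine Filter.Eventually.of_forall fun x => ?_
      have : Prod.mk x ⁻¹' Set.diagonal X = {x} := by
        ext y; simp [Set.mem_diagonal_iff, eq_comm]
      change μ (Prod.mk x ⁻¹' Set.diagonal X) = 0
      rw [this]; simp
  -- Inner regularity on pairs: a compact `Q` inside the off-diagonal part of `B ×ˢ B` encodes
  -- membership in `B` and distinctness at once, and makes the set `T` of good tuples compact.
  obtain ⟨Q, hQW, hQ, hQτ⟩ := hWm.exists_isCompact_sdiff_lt (μ := μ.prod μ)
    (measure_ne_top _ _) (ENNReal.ofReal_pos.2 hτ0).ne'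
  have hQc : (μ.prod μ).real Qᶜ ≤ τ := by
    refine ENNReal.toReal_le_of_le_ofReal hτ0.le ?_
    have : Qᶜ ⊆ Wᶜ ∪ (W \ Q) := by
      intro z hz; by_cases h : z ∈ W
      · exact Or.inr ⟨h, hz⟩
      · exact Or.inl h
    refine (measure_mono this).trans ((measure_union_le _ _).trans ?_)
    rw [hWc, zero_add]
    exact hQτ.le
  set T : Set (Fin n → X) := {x | ∀ k l, k ≠ l → (x k, x l) ∈ Q} with hT
  have hTcl : IsClosed T := by
    have : T = ⋂ (k : Fin n) (l : Fin n) (_ : k ≠ l), (fun x : Fin n → X => (x k, x l)) ⁻¹' Q := by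
      ext x; simp [hT]
    rw [this]
    exact isClosed_iInter fun k => isClosed_iInter fun l => isClosed_iInter fun _ =>
      hQ.isClosed.preimage (by fun_prop)
  have hTc : IsCompact T := by
    refine (isCompact_univ_pi fun _ : Fin n => hQ.image continuous_fst).of_isClosed_subset hTcl ?_
    intro x hx k _
    have : Nontrivial (Fin n) := Fin.nontrivial_iff_two_le.2 hn
    obtain ⟨l, hl⟩ := exists_ne k
    exact ⟨_, hx k l hl.symm, rfl⟩
  set S : (Fin n → X) → E := fun x => ∑ k, ψ (x k) with hS
  have hSc : Continuous S := by fun_prop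
  by_contra hcon
  have hne : ∀ x ∈ T, S x ≠ 0 := by
    intro x hx h0
    refine hcon ⟨x, fun k l hkl => ?_, fun k => ?_, h0⟩
    · by_contra hne
      exact (hQW (hx k l hne)).2 hkl
    · have : Nontrivial (Fin n) := Fin.nontrivial_iff_two_le.2 hn
      obtain ⟨l, hl⟩ := exists_ne k
      exact (hQW (hx k l hl.symm)).1.1
  obtain ⟨η, hη, hηT⟩ : ∃ η : ℝ, 0 < η ∧ ∀ x ∈ T, η ≤ ‖S x‖ := by
    rcases T.eq_empty_or_nonempty with h | h
    · exact ⟨1, one_pos, by simp [h]⟩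
    · obtain ⟨y, hy, hmin⟩ := hTc.exists_isMinOn h hSc.norm.continuousOn
      exact ⟨‖S y‖, norm_pos_iff.2 (hne y hy), fun x hx => hmin hx⟩
  obtain ⟨b, ⟨hb, hb1⟩, hbs⟩ : ∃ b : ℝ, (0 < b ∧ b ≤ 1) ∧
      (Real.pi / b) ^ ((Module.finrank ℝ E : ℝ) / 2) * Real.exp (-(η ^ 2 / (4 * b))) < c / 2 := by
    have h3 := (tendsto_rpow_mul_exp_neg_div ((Module.finrank ℝ E : ℝ) / 2) hη).eventually
      (gt_mem_nhds (half_pos hc))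
    have h4 : ∀ᶠ b : ℝ in nhdsWithin 0 (Set.Ioi 0), 0 < b ∧ b ≤ 1 := by
      filter_upwards [Ioc_mem_nhdsGT (zero_lt_one' ℝ)] with b hb using hb
    exact (h4.and h3).exists
  set P := Measure.pi fun _ : Fin n => μ with hP
  set g : (Fin n → X) → ℝ := fun x => gaussKernel b (S x) with hg
  have hgint : Integrable g P := integrable_gaussKernel_comp P hSc.measurable hb
  have hg0 : ∀ x, 0 ≤ g x := fun x => gaussKernel_nonneg hb _
  set χ : Fin n → Fin n → (Fin n → X) → ℝ := fun k l x =>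
    Qᶜ.indicator (fun _ => (1 : ℝ)) (x k, x l) * g x with hχ
  have hχ0 : ∀ k l x, 0 ≤ χ k l x := fun k l x =>
    mul_nonneg (Set.indicator_nonneg (fun _ _ => zero_le_one) _) (hg0 x)
  have hχint : ∀ k l, Integrable (χ k l) P := by
    intro k l
    refine hgint.bdd_mul (c := 1) ?_ (Filter.Eventually.of_forall fun x => ?_)
    · exact ((measurable_const.indicator hQ.isClosed.measurableSet.compl).comp
        (by fun_prop : Measurable fun x : Fin n → X => (x k, x l))).aestronglyMeasurable
    · by_cases hx : (x k, x l) ∈ Qᶜ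
      · simp [Set.indicator_of_mem hx]
      · simp [Set.indicator_of_notMem hx]
  set C₀ := (Real.pi / b) ^ ((Module.finrank ℝ E : ℝ) / 2) * Real.exp (-(η ^ 2 / (4 * b))) with hC₀
  have hC₀0 : 0 ≤ C₀ := by positivity
  -- On `T` the sum has norm at least `η`, so the kernel is at most `C₀`; off `T` some pair lies
  -- outside `Q` and its term is the whole of `g x`.
  have hpt : ∀ x, g x ≤ C₀ + ∑ k, ∑ l, if k ≠ l then χ k l x else 0 := by
    intro x
    have hterm : ∀ k l, 0 ≤ if k ≠ l then χ k l x else 0 := fun k l => by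
      split_ifs; exacts [hχ0 k l x, le_rfl]
    by_cases hx : x ∈ T
    · have := gaussKernel_le hb hη.le (hηT x hx)
      exact this.trans (le_add_of_nonneg_right
        (Finset.sum_nonneg fun k _ => Finset.sum_nonneg fun l _ => hterm k l))
    · simp only [hT, Set.mem_ofPred_eq, not_forall] at hx
      obtain ⟨k, l, hkl, hx⟩ := hx
      have h5 : g x = if k ≠ l then χ k l x else 0 := by
        rw [if_pos hkl, hχ]
        simp only
        rw [Set.indicator_of_mem hx, one_mul]
      calc g x = if k ≠ l then χ k l x else 0 := h5
        _ ≤ ∑ l, if k ≠ l then χ k l x else 0 :=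
          Finset.single_le_sum (f := fun l => if k ≠ l then χ k l x else 0)
            (fun l _ => hterm k l) (Finset.mem_univ l)
        _ ≤ ∑ k, ∑ l, if k ≠ l then χ k l x else 0 :=
          Finset.single_le_sum (f := fun k => ∑ l, if k ≠ l then χ k l x else 0)
            (fun k _ => Finset.sum_nonneg fun l _ => hterm k l) (Finset.mem_univ k)
        _ ≤ _ := le_add_of_nonneg_left hC₀0
  have hiint : ∀ k l, Integrable (fun x => if k ≠ l then χ k l x else 0) P := fun k l => by
    by_cases h : k ≠ l
    · simpa only [if_pos h] using hχint k l
    · simp only [if_neg h]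
      exact integrable_zero _ _ _
  have hbound : ∀ k l, ∫ x, (if k ≠ l then χ k l x else 0) ∂P ≤ τ * G := by
    intro k l
    by_cases h : k ≠ l
    · simp only [if_pos h]
      refine (integral_indicator_pair_gaussKernel_le μ hψ.measurable h
        hQ.isClosed.measurableSet.compl hb).trans ?_
      exact mul_le_mul hQc (h2 b hb) (integral_nonneg fun ξ => by positivity) hτ0.le
    · simp only [if_neg h, integral_zero]
      positivity
  have hfin : ∫ x, g x ∂P ≤ C₀ + n * (n * (τ * G)) := by
    calc ∫ x, g x ∂P ≤ ∫ x, (C₀ + ∑ k, ∑ l, if k ≠ l then χ k l x else 0) ∂P :=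
          integral_mono hgint ((integrable_const _).add (integrable_finsetSum _ fun k _ =>
            integrable_finsetSum _ fun l _ => hiint k l)) hpt
      _ = C₀ + ∑ k, ∑ l, ∫ x, (if k ≠ l then χ k l x else 0) ∂P := by
          rw [integral_add (integrable_const _) (integrable_finsetSum _ fun k _ =>
            integrable_finsetSum _ fun l _ => hiint k l),
            integral_finsetSum _ fun k _ => integrable_finsetSum _ fun l _ => hiint k l]
          congr 1
          · simp
          · exact Finset.sum_congr rfl fun k _ => integral_finsetSum _ fun l _ => hiint k l
      _ ≤ C₀ + ∑ k : Fin n, ∑ l : Fin n, τ * G := by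
          gcongr with k _ l _
          exact hbound k l
      _ = _ := by simp
  have hlow := h1 b hb hb1
  rw [← integral_gaussKernel_sum μ hψ.measurable hb] at hlow
  have hτG : n * (n * (τ * G)) ≤ c / 4 := by
    calc n * (n * (τ * G)) ≤ n * (n * (τ * (G + 1))) := by gcongr; linarith
      _ = c / 4 := by rw [hτ]; field_simp
  have : c ≤ ∫ x, g x ∂P := hlow
  linarith

end ExactHit

/-! ### Equal-weight quadrature for dominated measures -/

theorem norm_exp_I_mul_sub_quadratic_le (t : ℝ) :
    ‖Complex.exp (Complex.I * t) - 1 - Complex.I * t + t ^ 2 / 2‖ ≤ 4 * |t| ^ 3 := by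
  have hn : ‖Complex.I * (t : ℂ)‖ = |t| := by simp
  rcases le_or_gt |t| 1 with ht | ht
  · have := Complex.exp_bound (x := Complex.I * t) (by rw [hn]; exact ht) (n := 3) (by norm_num)
    rw [hn] at this
    have e : Complex.exp (Complex.I * t) - 1 - Complex.I * t + t ^ 2 / 2 =
        Complex.exp (Complex.I * t) -
          ∑ m ∈ Finset.range 3, (Complex.I * t) ^ m / (Nat.factorial m : ℂ) := by
      simp only [Finset.sum_range_succ, Finset.sum_range_zero, mul_pow, Complex.I_sq]
      norm_num [Nat.factorial]
      ring
    rw [e]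
    refine this.trans ?_
    rw [mul_comm]
    gcongr
    norm_num [Nat.factorial]
  · have h1 : ‖Complex.exp (Complex.I * t) - 1 - Complex.I * t + t ^ 2 / 2‖ ≤
        1 + 1 + |t| + |t| ^ 2 / 2 := by
      refine (norm_add_le _ _).trans (add_le_add ((norm_sub_le _ _).trans (add_le_add
        ((norm_sub_le _ _).trans (add_le_add (norm_exp_I_mul_ofReal' t).le (by simp))) hn.le)) ?_)
      simp
    refine h1.trans ?_
    nlinarith [mul_pos (sub_pos.2 ht) (sub_pos.2 ht), mul_pos (mul_pos (sub_pos.2 ht) (sub_pos.2 ht)) (sub_pos.2 ht)]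

section Combine

variable {X E : Type*} [MeasurableSpace X] [NormedAddCommGroup E] [InnerProductSpace ℝ E]
  [MeasurableSpace E] [BorelSpace E] [FiniteDimensional ℝ E]

theorem norm_charAlong_sub_const (μ : Measure X) (φ : X → E) (M ξ : E) :
    ‖charAlong μ (fun x => φ x - M) ξ‖ = ‖charAlong μ φ ξ‖ := by
  have : charAlong μ (fun x => φ x - M) ξ =
      Complex.exp (((-inner ℝ ξ M : ℝ) : ℂ) * Complex.I) * charAlong μ φ ξ := by
    rw [charAlong, charAlong, ← integral_const_mul]
    congr with x
    rw [← Complex.exp_add, inner_sub_right]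
    congr 1
    push_cast
    ring
  rw [this, norm_mul, Complex.norm_exp_ofReal_mul_I, one_mul]

theorem norm_charAlong_sub_quadratic_le (μ : Measure X) [IsProbabilityMeasure μ] {ψ : X → E}
    (hψ : Measurable ψ) {A : ℝ} (hA : ∀ᵐ x ∂μ, ‖ψ x‖ ≤ A) (hψ0 : ∫ x, ψ x ∂μ = 0) (ξ : E) :
    ‖charAlong μ ψ ξ - (1 - (∫ x, (inner ℝ ξ (ψ x)) ^ 2 ∂μ) / 2 : ℝ)‖ ≤ 4 * (A * ‖ξ‖) ^ 3 := by
  have hψi : Integrable ψ μ := (integrable_const A).mono' hψ.aestronglyMeasurable hA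
  have hb : ∀ᵐ x ∂μ, |inner ℝ ξ (ψ x)| ≤ A * ‖ξ‖ := by
    filter_upwards [hA] with x hx
    refine (abs_real_inner_le_norm _ _).trans ?_
    rw [mul_comm]; gcongr
  have hm := measurable_inner_comp hψ ξ
  have i1 : Integrable (fun x => (inner ℝ ξ (ψ x) : ℝ)) μ :=
    (integrable_const (A * ‖ξ‖)).mono' hm.aestronglyMeasurable hb
  have i2 : Integrable (fun x => (inner ℝ ξ (ψ x)) ^ 2) μ := by
    refine (integrable_const ((A * ‖ξ‖) ^ 2)).mono' (hm.pow_const 2).aestronglyMeasurable ?_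
    filter_upwards [hb] with x hx
    rw [norm_pow, Real.norm_eq_abs]
    gcongr
  have h0 : ∫ x, (inner ℝ ξ (ψ x) : ℝ) ∂μ = 0 := by
    rw [integral_inner hψi, hψ0, inner_zero_right]
  have i0 := integrable_exp_inner μ hψ ξ
  have i1' : Integrable (fun x => Complex.I * ((inner ℝ ξ (ψ x) : ℝ) : ℂ)) μ :=
    i1.ofReal.const_mul _
  have i2' : Integrable (fun x => (((inner ℝ ξ (ψ x)) ^ 2 / 2 : ℝ) : ℂ)) μ :=
    (i2.div_const 2).ofReal
  have e : charAlong μ ψ ξ - (1 - (∫ x, (inner ℝ ξ (ψ x)) ^ 2 ∂μ) / 2 : ℝ) =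
      ∫ x, (Complex.exp (Complex.I * (inner ℝ ξ (ψ x) : ℝ)) - 1 - Complex.I * (inner ℝ ξ (ψ x) : ℝ)
        + (((inner ℝ ξ (ψ x)) ^ 2 / 2 : ℝ) : ℂ)) ∂μ := by
    have j1 : Integrable (fun x => Complex.exp (Complex.I * (inner ℝ ξ (ψ x) : ℝ)) - 1) μ :=
      i0.sub (integrable_const 1)
    have j2 : Integrable (fun x => Complex.exp (Complex.I * (inner ℝ ξ (ψ x) : ℝ)) - 1 -
        Complex.I * ((inner ℝ ξ (ψ x) : ℝ) : ℂ)) μ := j1.sub i1'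
    rw [integral_add j2 i2', integral_sub j1 i1', integral_sub i0 (integrable_const 1),
      integral_const_mul,
      integral_complex_ofReal, integral_complex_ofReal, h0, integral_div, charAlong]
    simp
    ring
  rw [e]
  have := norm_integral_le_of_norm_le_const (μ := μ) (C := 4 * (A * ‖ξ‖) ^ 3)
    (f := fun x => Complex.exp (Complex.I * (inner ℝ ξ (ψ x) : ℝ)) - 1 -
      Complex.I * (inner ℝ ξ (ψ x) : ℝ) + (((inner ℝ ξ (ψ x)) ^ 2 / 2 : ℝ) : ℂ)) (by
    filter_upwards [hb] with x hx
    have h := norm_exp_I_mul_sub_quadratic_le (inner ℝ ξ (ψ x))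
    push_cast
    refine h.trans ?_
    gcongr)
  simpa using this

/-- Equal-weight quadrature with distinct nodes for measures dominated by a measure whose
characteristic function decays polynomially. -/
theorem exists_injective_sum_sub_mean_eq_zero [MetricSpace X] [ProperSpace X] [BorelSpace X]
    (μ₀ : Measure X) [IsFiniteMeasure μ₀] {φ : X → E} (hφ : Continuous φ) {C δ : ℝ} (hδ : 0 < δ)
    (hC : ∀ ξ, ‖charAlong μ₀ φ ξ‖ ≤ C * (1 + ‖ξ‖) ^ (-δ)) (A₀ : ℝ) :
    ∃ N : ℕ, ∀ n : ℕ, N ≤ n → ∀ (μ : Measure X) [IsProbabilityMeasure μ] [NullSingletonClass μ]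
      (B : Set X), μ ≤ μ₀ → MeasurableSet B → μ Bᶜ = 0 → (∀ x ∈ B, ‖φ x‖ ≤ A₀) →
      ∃ x : Fin n → X, Function.Injective x ∧ (∀ k, x k ∈ B) ∧
        ∑ k, (φ (x k) - ∫ y, φ y ∂μ) = 0 := by
  obtain ⟨R, hR1, hR⟩ : ∃ R : ℝ, 1 ≤ R ∧ ∀ ξ : E, R ≤ ‖ξ‖ → ‖charAlong μ₀ φ ξ‖ ≤ 1 / 2 := by
    have h1 : Filter.Tendsto (fun r : ℝ => C * (1 + r) ^ (-δ)) Filter.atTop (nhds (C * 0)) :=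
      ((tendsto_rpow_neg_atTop hδ).comp
        (Filter.tendsto_atTop_add_const_left _ 1 Filter.tendsto_id)).const_mul C
    rw [mul_zero] at h1
    obtain ⟨R, hR⟩ := Filter.eventually_atTop.1
      (h1.eventually (ge_mem_nhds (show (0 : ℝ) < 1 / 2 by norm_num)))
    exact ⟨max 1 R, le_max_left _ _, fun ξ hξ =>
      (hC ξ).trans (hR _ ((le_max_right _ _).trans hξ))⟩
  obtain ⟨κ, hκ, hκ1, hκb⟩ := exists_norm_charAlong_sq_le μ₀ hφ.measurable hR1 hR
  -- The power `2 * m` makes the decay bound for `μ₀` integrable over `E`.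
  obtain ⟨m, hm⟩ := exists_nat_gt ((Module.finrank ℝ E : ℝ) / (2 * δ))
  have hm' : (Module.finrank ℝ E : ℝ) < 2 * m * δ := by
    rw [div_lt_iff₀ (by positivity)] at hm; linarith
  have hdecay := integrable_one_add_norm (E := E) (μ := volume) hm'
  set K := ∫ ξ : E, C ^ (2 * m) * (1 + ‖ξ‖) ^ (-(2 * m * δ)) with hK
  -- Centring at most doubles the bound `A₀`; the factor `4` absorbs the constant of the cubic
  -- Taylor error.
  set A := max 1 (4 * (A₀ + A₀)) with hA
  have hA1 : 1 ≤ A := le_max_left _ _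
  obtain ⟨N, hN⟩ := exists_gaussian_integral_pow_lower_bound (E := E) (K := K) hκ hκ1 hA1 m
  -- `2 * m` characteristic factors must survive the removal of a pair.
  refine ⟨max N (2 * m + 2), fun n hn μ _ _ B hμ hB hμB hφB => ?_⟩
  obtain ⟨c, hc, hcb⟩ := hN n ((le_max_left _ _).trans hn)
  have hnm : 2 * m + 2 ≤ n := (le_max_right _ _).trans hn
  have hae : ∀ᵐ x ∂μ, x ∈ B := mem_ae_iff.2 hμB
  have hφae : ∀ᵐ x ∂μ, ‖φ x‖ ≤ A₀ := hae.mono hφB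
  set M := ∫ y, φ y ∂μ with hM
  have hMA : ‖M‖ ≤ A₀ := by simpa using norm_integral_le_of_norm_le_const hφae
  have hφi : Integrable φ μ := (integrable_const A₀).mono' hφ.aestronglyMeasurable hφae
  set ψ : X → E := fun x => φ x - M with hψ
  have hψc : Continuous ψ := hφ.sub continuous_const
  have hψA : ∀ᵐ x ∂μ, ‖ψ x‖ ≤ A₀ + A₀ :=
    hφae.mono fun x hx => (norm_sub_le _ _).trans (add_le_add hx hMA)
  have hA₀ : 0 ≤ A₀ := (norm_nonneg _).trans hMA
  have hψ0 : ∫ x, ψ x ∂μ = 0 := by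
    rw [hψ, integral_sub hφi (integrable_const _)]; simp [hM]
  have hnormeq : ∀ ξ, ‖charAlong μ ψ ξ‖ = ‖charAlong μ φ ξ‖ := norm_charAlong_sub_const μ φ M
  have hf1 : ∀ ξ, ‖charAlong μ ψ ξ‖ ≤ 1 := fun ξ => by simpa using norm_charAlong_le μ ψ ξ
  have h4A : 4 * (A₀ + A₀) ≤ A := le_max_right _ _
  have hKb : ∀ b : ℝ, 0 < b →
      ∫ ξ, ‖charAlong μ ψ ξ‖ ^ (2 * m) * Real.exp (-b * ‖ξ‖ ^ 2) ≤ K := by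
    intro b hb
    simp only [hnormeq]
    refine (integral_norm_charAlong_pow_mul_mono hμ hφ.measurable m
      (hasNonnegCosTransform_gaussian hb)).trans ?_
    refine integral_mono_of_nonneg (Filter.Eventually.of_forall fun ξ => by positivity)
      (hdecay.const_mul _) (Filter.Eventually.of_forall fun ξ => ?_)
    have h1 : Real.exp (-b * ‖ξ‖ ^ 2) ≤ 1 := Real.exp_le_one_iff.2 (by
      have := sq_nonneg ‖ξ‖; nlinarith)
    calc ‖charAlong μ₀ φ ξ‖ ^ (2 * m) * Real.exp (-b * ‖ξ‖ ^ 2)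
        ≤ (C * (1 + ‖ξ‖) ^ (-δ)) ^ (2 * m) * 1 :=
          mul_le_mul (pow_le_pow_left₀ (norm_nonneg _) (hC ξ) _) h1 (Real.exp_pos _).le
            (pow_nonneg ((norm_nonneg _).trans (hC ξ)) _)
      _ = _ := by
        rw [mul_one, mul_pow, ← Real.rpow_natCast (_ ^ (-δ)), ← Real.rpow_mul (by positivity)]
        congr 2
        push_cast; ring
  refine exists_injective_sum_eq_zero (G := K) (by omega) μ hψc hB hμB hc ?_ ?_
  · refine hcb (charAlong μ ψ) (fun ξ => ∫ x, (inner ℝ ξ (ψ x)) ^ 2 ∂μ)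
      (continuous_charAlong μ hψc.measurable) ?_ ?_ ?_ hKb
    · intro ξ; rw [hnormeq]; exact hκb μ hμ ξ
    · intro ξ
      have := norm_integral_le_of_norm_le_const (μ := μ) (C := A ^ 2 * ‖ξ‖ ^ 2)
        (f := fun x => (inner ℝ ξ (ψ x)) ^ 2) (by
        filter_upwards [hψA] with x hx
        rw [norm_pow, ← mul_pow, Real.norm_eq_abs]
        have h5 : |inner ℝ ξ (ψ x)| ≤ A * ‖ξ‖ := by
          refine (abs_real_inner_le_norm _ _).trans ?_
          rw [mul_comm]
          gcongr
          linarith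
        gcongr)
      simp only [probReal_univ, mul_one] at this
      exact (Real.le_norm_self _).trans this
    · intro ξ
      refine (norm_charAlong_sub_quadratic_le μ hψc.measurable hψA hψ0 ξ).trans ?_
      calc 4 * ((A₀ + A₀) * ‖ξ‖) ^ 3 ≤ 4 ^ 3 * ((A₀ + A₀) * ‖ξ‖) ^ 3 := by
            gcongr; norm_num
        _ = (4 * (A₀ + A₀)) ^ 3 * ‖ξ‖ ^ 3 := by ring
        _ ≤ _ := by gcongr
  · intro b hb
    refine le_trans (integral_mono_of_nonneg (Filter.Eventually.of_forall fun ξ => by positivity)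
      ?_ (Filter.Eventually.of_forall fun ξ => ?_)) (hKb b hb)
    · refine (integrable_gaussian hb).bdd_mul (c := 1)
        ((continuous_charAlong μ hψc.measurable).norm.pow _).aestronglyMeasurable
        (Filter.Eventually.of_forall fun ξ => ?_)
      change ‖‖charAlong μ ψ ξ‖ ^ (2 * m)‖ ≤ 1
      rw [norm_pow, norm_norm]
      exact pow_le_one₀ (norm_nonneg _) (hf1 ξ)
    · exact mul_le_mul_of_nonneg_right
        (pow_le_pow_of_le_one (norm_nonneg _) (hf1 ξ) (by omega)) (Real.exp_pos _).le

end Combine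

/-! ### Averaging sets and affine invariance -/

/-- Bounded sets of volume bounded below carry equal-weight quadratures for all monomials. -/
theorem exists_injective_sum_monomialMap_eq (d : ℕ) (hd : 1 ≤ d) (p : ℕ) (R : ℝ) {c : ℝ}
    (hc : 0 < c) :
    ∃ N : ℕ, ∀ n : ℕ, N ≤ n → ∀ B : Set (EuclideanSpace ℝ (Fin d)), MeasurableSet B →
      B ⊆ Metric.closedBall 0 R → ENNReal.ofReal c ≤ volume B →
      ∃ x : Fin n → EuclideanSpace ℝ (Fin d), Function.Injective x ∧ (∀ k, x k ∈ B) ∧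
        ∑ k, (monomialMap d p (x k) -
          (volume.real B)⁻¹ • ∫ y in B, monomialMap d p y) = 0 := by
  have : Nonempty (Fin d) := ⟨⟨0, hd⟩⟩
  obtain ⟨ν, hν, hνR, C, δ, hC, hδ, hdec⟩ := exists_dominating_measure d p R
  obtain ⟨A₀, hA₀⟩ : ∃ A₀ : ℝ, ∀ x ∈ Metric.closedBall (0 : EuclideanSpace ℝ (Fin d)) R,
      ‖monomialMap d p x‖ ≤ A₀ :=
    (isCompact_closedBall _ _).exists_bound_of_continuousOn (continuous_monomialMap d p).continuousOn
  have hfin : IsFiniteMeasure ((ENNReal.ofReal c)⁻¹ • ν) :=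
    ν.smul_finite (ENNReal.inv_ne_top.2 (ENNReal.ofReal_pos.2 hc).ne')
  obtain ⟨N, hN⟩ := exists_injective_sum_sub_mean_eq_zero ((ENNReal.ofReal c)⁻¹ • ν)
    (continuous_monomialMap d p) (C := c⁻¹ * C) hδ (fun ξ => by
      rw [charAlong, integral_smul_measure, norm_smul, ENNReal.toReal_inv,
        ENNReal.toReal_ofReal hc.le, Real.norm_of_nonneg (by positivity), mul_assoc]
      gcongr
      exact hdec ξ) A₀
  refine ⟨N, fun n hn B hB hBR hBc => ?_⟩
  have hB0 : volume B ≠ 0 := ((ENNReal.ofReal_pos.2 hc).trans_le hBc).ne'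
  have hBt : volume B ≠ ⊤ := ((measure_mono hBR).trans_lt measure_closedBall_lt_top).ne
  set μ : Measure (EuclideanSpace ℝ (Fin d)) := (volume B)⁻¹ • volume.restrict B with hμ
  have hprob : IsProbabilityMeasure μ := ⟨by
    rw [hμ, Measure.smul_apply, Measure.restrict_apply_univ, smul_eq_mul,
      ENNReal.inv_mul_cancel hB0 hBt]⟩
  have hatoms : NullSingletonClass μ := ⟨fun x => by rw [hμ, Measure.smul_apply]; simp⟩
  have hμν : μ ≤ (ENNReal.ofReal c)⁻¹ • ν := by
    refine Measure.le_iff.2 fun S _ => ?_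
    rw [hμ, Measure.smul_apply, Measure.smul_apply]
    exact mul_le_mul' (ENNReal.inv_le_inv.2 hBc)
      (((Measure.restrict_mono hBR le_rfl).trans hνR) S)
  obtain ⟨x, hx1, hx2, hx3⟩ := hN n hn μ B hμν hB (by
    rw [hμ, Measure.smul_apply, Measure.restrict_apply hB.compl]; simp) fun x hx => hA₀ x (hBR hx)
  refine ⟨x, hx1, hx2, ?_⟩
  rw [hμ, integral_smul_measure, ENNReal.toReal_inv] at hx3
  exact hx3

theorem continuous_polyFun {d p : ℕ} (P : {P : MvPolynomial (Fin d) ℝ // P.totalDegree ≤ p}) :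
    Continuous (polyFun d p P) := by
  unfold polyFun
  exact (MvPolynomial.continuous_eval P.1).comp (by fun_prop)

/-- By linearity it suffices to treat monomials, and total degree at most `p` keeps every exponent
at most `p`. The constant monomial, absent from `monomialMap`, is averaged exactly because `n` and
the volume are positive. -/
theorem isAveragingSet_of_sum_monomialMap_eq {d n p : ℕ} (hn : 0 < n)
    {B : Set (EuclideanSpace ℝ (Fin d))} (hB : Bornology.IsBounded B) (hB0 : volume B ≠ 0)
    {x : Fin n → EuclideanSpace ℝ (Fin d)}
    (hx : ∑ k, (monomialMap d p (x k) - (volume.real B)⁻¹ • ∫ y in B, monomialMap d p y) = 0) :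
    IsAveragingSet B p x := by
  have hBt : volume B ≠ ⊤ := hB.measure_lt_top.ne
  have hV : 0 < volume.real B := ENNReal.toReal_pos hB0 hBt
  have hn0 : (0 : ℝ) < n := by exact_mod_cast hn
  have hint : ∀ {F : Type} [NormedAddCommGroup F] {f : EuclideanSpace ℝ (Fin d) → F},
      Continuous f → IntegrableOn f B := fun {F} _ {f} hf =>
    (hf.continuousOn.integrableOn_compact hB.isCompact_closure).mono_set subset_closure
  refine ⟨hn, ⟨by simpa using hBt.lt_top⟩, by simpa using hB0, fun P =>
    hint (continuous_polyFun P), fun P => ?_⟩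
  have hmon : ∀ s ∈ P.1.support, (1 / volume.real B) * ∫ y in B, ∏ i, y i ^ s i =
      (1 / (n : ℝ)) * ∑ k, ∏ i, x k i ^ s i := by
    intro s hs
    by_cases hs0 : s = 0
    · subst hs0
      simp
      field_simp
    have hsp : ∀ i, s i < p + 1 := fun i => by
      have h1 := (MvPolynomial.le_totalDegree hs).trans P.2
      have h2 : s i ≤ s.sum fun _ e => e := by
        by_cases hi : i ∈ s.support
        · exact Finset.single_le_sum (f := fun i => s i) (fun _ _ => Nat.zero_le _) hi
        · rw [Finsupp.notMem_support_iff.1 hi]; exact Nat.zero_le _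
      omega
    let a : MonomialIndex d p := ⟨fun i => ⟨s i, hsp i⟩, fun h => hs0 (by
      ext i
      have := congrArg Fin.val (congrFun h i)
      simpa using this)⟩
    have h := congrArg (fun v : EuclideanSpace ℝ (MonomialIndex d p) => EuclideanSpace.proj a v) hx
    simp only [map_sum, map_sub, map_smul, map_zero] at h
    rw [← ContinuousLinearMap.integral_comp_comm _ (hint (continuous_monomialMap d p))] at h
    have e : ∀ y, (EuclideanSpace.proj a : EuclideanSpace ℝ (MonomialIndex d p) →L[ℝ] ℝ)
      (monomialMap d p y) = ∏ i, y i ^ s i := fun y => rfl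
    simp only [e, Finset.sum_sub_distrib, Finset.sum_const, Finset.card_univ, Fintype.card_fin,
      nsmul_eq_mul, smul_eq_mul] at h
    rw [sub_eq_zero.1 h]
    field_simp
  simp only [polyFun, MvPolynomial.eval_eq', measureReal_restrict_apply_univ]
  have hi : ∀ s : Fin d →₀ ℕ, Integrable (fun y : EuclideanSpace ℝ (Fin d) => ∏ i, y i ^ s i)
      (volume.restrict B) := fun s => hint (by fun_prop)
  rw [integral_finsetSum _ fun s _ => (hi s).const_mul _, Finset.mul_sum,
    Finset.sum_comm, Finset.mul_sum]
  refine Finset.sum_congr rfl fun s hs => ?_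
  rw [integral_const_mul, ← Finset.mul_sum, mul_left_comm, hmon s hs, mul_left_comm]

/-- Substituting an affine map into a polynomial function. -/
theorem exists_polyFun_comp_affine {d p : ℕ} (v : EuclideanSpace ℝ (Fin d))
    (L : EuclideanSpace ℝ (Fin d) ≃L[ℝ] EuclideanSpace ℝ (Fin d))
    (P : {P : MvPolynomial (Fin d) ℝ // P.totalDegree ≤ p}) :
    ∃ P' : {P : MvPolynomial (Fin d) ℝ // P.totalDegree ≤ p},
      ∀ y, polyFun d p P' y = polyFun d p P (v + L y) := by
  let ℓ : Fin d → MvPolynomial (Fin d) ℝ := fun i => MvPolynomial.C (v i) +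
    ∑ j, MvPolynomial.C (L (EuclideanSpace.single j 1) i) * MvPolynomial.X j
  have hℓ : ∀ i, (ℓ i).totalDegree ≤ 1 := fun i => by
    refine (MvPolynomial.totalDegree_add _ _).trans (max_le (by simp) ?_)
    refine MvPolynomial.totalDegree_finsetSum_le fun j _ => ?_
    refine (MvPolynomial.totalDegree_mul _ _).trans ?_
    simp
  have hev : ∀ i y, MvPolynomial.eval (fun j : Fin d => (y : EuclideanSpace ℝ (Fin d)) j) (ℓ i) =
      (v + L y) i := by
    intro i y
    have hy : y = ∑ j, y j • EuclideanSpace.single j (1 : ℝ) := by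
      ext k; simp [Finset.sum_apply, Pi.single_apply]
    have hL : L y i = ∑ j, L (EuclideanSpace.single j 1) i * y j := by
      conv_lhs => rw [hy]
      simp [mul_comm]
    simp [ℓ, hL]
  refine ⟨⟨MvPolynomial.bind₁ ℓ P.1, ?_⟩, fun y => ?_⟩
  · rw [MvPolynomial.as_sum P.1, map_sum]
    refine MvPolynomial.totalDegree_finsetSum_le fun s hs => ?_
    rw [MvPolynomial.bind₁_monomial]
    refine (MvPolynomial.totalDegree_mul _ _).trans ?_
    rw [MvPolynomial.totalDegree_C, zero_add]
    refine (MvPolynomial.totalDegree_finsetProd _ _).trans ?_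
    refine le_trans (Finset.sum_le_sum fun i _ => ?_) ((MvPolynomial.le_totalDegree hs).trans P.2)
    refine (MvPolynomial.totalDegree_pow _ _).trans ?_
    exact mul_le_of_le_one_right (Nat.zero_le _) (hℓ i)
  · simp only [polyFun]
    rw [MvPolynomial.eval, MvPolynomial.eval₂Hom_bind₁]
    congr 1
    congr 1
    funext i
    exact hev i y

/-- The Jacobian cancels in the mean, and affine substitution preserves the degree bound. -/
theorem IsAveragingSet.image_affine {d n p : ℕ} {B : Set (EuclideanSpace ℝ (Fin d))}
    (hB0 : volume B ≠ 0) (hBt : volume B ≠ ⊤)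
    (v : EuclideanSpace ℝ (Fin d)) (L : EuclideanSpace ℝ (Fin d) ≃L[ℝ] EuclideanSpace ℝ (Fin d))
    {y : Fin n → EuclideanSpace ℝ (Fin d)}
    (hy : IsAveragingSet ((fun y => v + L y) ⁻¹' B) p y) :
    IsAveragingSet B p (fun k => v + L (y k)) := by
  set g : EuclideanSpace ℝ (Fin d) → EuclideanSpace ℝ (Fin d) := fun y => v + L y with hg
  have hgm : MeasurableEmbedding g :=
    (L.toHomeomorph.trans (Homeomorph.addLeft v)).measurableEmbedding
  have hdet : LinearMap.det (L : EuclideanSpace ℝ (Fin d) →ₗ[ℝ] EuclideanSpace ℝ (Fin d)) ≠ 0 :=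
    (LinearEquiv.isUnit_det' L.toLinearEquiv).ne_zero
  set r : ℝ := |(LinearMap.det (L : EuclideanSpace ℝ (Fin d) →ₗ[ℝ] EuclideanSpace ℝ (Fin d)))⁻¹|
    with hr
  have hr0 : 0 < r := abs_pos.2 (inv_ne_zero hdet)
  have hmap : Measure.map g volume = ENNReal.ofReal r • volume := by
    have h1 := Measure.map_linearMap_addHaar_eq_smul_addHaar (volume : Measure (EuclideanSpace ℝ (Fin d))) hdet
    have h2 : Measure.map g volume = Measure.map (fun z => v + z) (Measure.map L volume) := by
      rw [Measure.map_map (by fun_prop) L.continuous.measurable]; rfl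
    rw [h2]
    change Measure.map (fun z => v + z) (Measure.map (L : EuclideanSpace ℝ (Fin d) →ₗ[ℝ] EuclideanSpace ℝ (Fin d)) volume) = _
    rw [h1, Measure.map_smul, map_add_left_eq_self]
  have hres : Measure.map g (volume.restrict (g ⁻¹' B)) = ENNReal.ofReal r • volume.restrict B := by
    rw [← hgm.restrict_map, hmap, Measure.restrict_smul]
  have hint : ∀ f : EuclideanSpace ℝ (Fin d) → ℝ,
      ∫ z in g ⁻¹' B, f (g z) = r * ∫ z in B, f z := by
    intro f
    rw [← hgm.integral_map, hres, integral_smul_measure, ENNReal.toReal_ofReal hr0.le, smul_eq_mul]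
  have hvol : (volume.restrict (g ⁻¹' B)).real Set.univ = r * (volume.restrict B).real Set.univ := by
    have := hint fun _ => 1
    simpa using this
  obtain ⟨h1, h2, h3, h4, h5⟩ := hy
  refine ⟨h1, ⟨by simpa using hBt.lt_top⟩, by simpa using hB0, fun P => ?_, fun P => ?_⟩
  · obtain ⟨P', hP'⟩ := exists_polyFun_comp_affine v L P
    have h := h4 P'
    have e : polyFun d p P' = polyFun d p P ∘ g := funext hP'
    rw [e, ← hgm.integrable_map_iff, hres] at h
    exact (integrable_smul_measure (ENNReal.ofReal_pos.2 hr0).ne' ENNReal.ofReal_ne_top).1 h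
  · obtain ⟨P', hP'⟩ := exists_polyFun_comp_affine v L P
    have h := h5 P'
    simp only [hP'] at h
    rw [hvol] at h
    have hi := hint (polyFun d p P)
    simp only [hg] at hi h
    rw [hi] at h
    rw [← h]
    field_simp

/-- The averaging theorem for sets in a normalized position with respect to some affine frame. -/
theorem exists_averagingSet_of_affine (d : ℕ) (hd : 1 ≤ d) (p : ℕ) (R : ℝ) {c : ℝ} (hc : 0 < c) :
    ∃ N : ℕ, ∀ n : ℕ, N ≤ n → ∀ B : Set (EuclideanSpace ℝ (Fin d)), MeasurableSet B →
      Bornology.IsBounded B → 0 < volume B → ∀ (v : EuclideanSpace ℝ (Fin d))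
        (L : EuclideanSpace ℝ (Fin d) ≃L[ℝ] EuclideanSpace ℝ (Fin d)),
      (fun y => v + L y) ⁻¹' B ⊆ Metric.closedBall 0 R →
      ENNReal.ofReal c ≤ volume ((fun y => v + L y) ⁻¹' B) →
      ∃ x : Fin n → EuclideanSpace ℝ (Fin d),
        (∀ k, x k ∈ B) ∧ Function.Injective x ∧ IsAveragingSet B p x := by
  obtain ⟨N, hN⟩ := exists_injective_sum_monomialMap_eq d hd p R hc
  refine ⟨max 1 N, fun n hn B hB hBb hB0 v L hR hcB => ?_⟩
  have hgm : Measurable fun y => v + L y := (by fun_prop : Continuous fun y => v + L y).measurable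
  obtain ⟨y, hy1, hy2, hy3⟩ := hN n ((le_max_right _ _).trans hn) _ (hgm hB) hR hcB
  refine ⟨fun k => v + L (y k), hy2, fun k l hkl => hy1 (L.injective (add_left_cancel hkl)), ?_⟩
  refine IsAveragingSet.image_affine hB0.ne' hBb.measure_lt_top.ne v L ?_
  exact isAveragingSet_of_sum_monomialMap_eq ((le_max_left _ _).trans hn)
    (Metric.isBounded_closedBall.subset hR) ((ENNReal.ofReal_pos.2 hc).trans_le hcB).ne' hy3

/-! ### Normalized position and the two geometric hypotheses -/

theorem exists_volume_preimage_affine_eq_mul {d : ℕ} (v : EuclideanSpace ℝ (Fin d))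
    (L : EuclideanSpace ℝ (Fin d) ≃L[ℝ] EuclideanSpace ℝ (Fin d)) :
    ∃ r : ENNReal, ∀ S, volume ((fun y => v + L y) ⁻¹' S) = r * volume S := by
  refine ⟨ENNReal.ofReal |LinearMap.det
    (L.symm : EuclideanSpace ℝ (Fin d) →ₗ[ℝ] EuclideanSpace ℝ (Fin d))|, fun S => ?_⟩
  rw [show (fun y => v + L y) ⁻¹' S = L ⁻¹' ((fun z => v + z) ⁻¹' S) from rfl,
    Measure.addHaar_preimage_continuousLinearEquiv, measure_preimage_add]

theorem norm_le_sqrt_of_forall_abs_le_one {d : ℕ} {y : EuclideanSpace ℝ (Fin d)}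
    (hy : ∀ i, |y i| ≤ 1) : ‖y‖ ≤ √d := by
  rw [EuclideanSpace.norm_eq]
  refine Real.sqrt_le_sqrt ?_
  calc ∑ i, ‖y i‖ ^ 2 ≤ ∑ _i : Fin d, (1 : ℝ) :=
        Finset.sum_le_sum fun i _ => pow_le_one₀ (norm_nonneg _) (hy i)
    _ = d := by simp

theorem Convex.measure_closure {E : Type*} [NormedAddCommGroup E] [NormedSpace ℝ E]
    [MeasurableSpace E] [BorelSpace E] [FiniteDimensional ℝ E] (μ : Measure E) [μ.IsAddHaarMeasure]
    {s : Set E} (hs : Convex ℝ s) : μ (closure s) = μ s := by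
  refine le_antisymm ?_ (measure_mono subset_closure)
  rw [closure_eq_self_union_frontier]
  exact (measure_union_le _ _).trans (by rw [hs.addHaar_frontier μ, add_zero])

/-- A set of positive volume contains affine frames with any of its points as origin. -/
theorem exists_mem_basis_det_ne_zero {d : ℕ} {B : Set (EuclideanSpace ℝ (Fin d))}
    (hB0 : 0 < volume B) (b₀ : EuclideanSpace ℝ (Fin d)) :
    ∃ w : Fin d → EuclideanSpace ℝ (Fin d), (∀ i, w i ∈ B) ∧
      (EuclideanSpace.basisFun (Fin d) ℝ).toBasis.det (fun i => w i - b₀) ≠ 0 := by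
  set e := (EuclideanSpace.basisFun (Fin d) ℝ).toBasis with he
  -- Otherwise the translate of `B` lies in a proper subspace, which is null.
  have hspan : ⊤ ≤ Submodule.span ℝ ((fun x => x - b₀) '' B) := by
    by_contra hne
    have hne' : Submodule.span ℝ ((fun x => x - b₀) '' B) ≠ ⊤ := fun h => hne h.ge
    have h0 := Measure.addHaar_submodule volume _ hne'
    have h1 : volume ((fun x => b₀ + x) ⁻¹' B) = 0 := by
      refine measure_mono_null (fun x hx => ?_) h0
      exact Submodule.subset_span ⟨b₀ + x, hx, by simp⟩
    rw [measure_preimage_add] at h1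
    exact hB0.ne' h1
  let b := Module.Basis.ofSpan hspan
  let b' := b.reindex (b.indexEquiv e)
  refine ⟨fun i => b' i + b₀, fun i => ?_, ?_⟩
  · have : b' i ∈ (fun x => x - b₀) '' B := by
      refine Module.Basis.ofSpan_subset hspan ⟨(b.indexEquiv e).symm i, ?_⟩
      simp [b', b]
    obtain ⟨x, hx, hxi⟩ := this
    change b' i + b₀ ∈ B
    rw [← hxi]
    simpa using hx
  · simpa using (e.isUnit_det b').ne_zero

/-- A frame of maximal volume in the closure of `B`: in its coordinates, `B` lies in the unit cube
and the convex hull of the closure of `B` contains the standard simplex. -/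
theorem exists_affine_normalization {d : ℕ} {B : Set (EuclideanSpace ℝ (Fin d))}
    (hBb : Bornology.IsBounded B) (hB0 : 0 < volume B) :
    ∃ (v : EuclideanSpace ℝ (Fin d))
      (L : EuclideanSpace ℝ (Fin d) ≃L[ℝ] EuclideanSpace ℝ (Fin d)),
      (∀ y, v + L y ∈ B → ∀ i, |y i| ≤ 1) ∧
      ∀ y : EuclideanSpace ℝ (Fin d), (∀ i, 0 < y i) → ∑ i, y i < 1 →
        v + L y ∈ convexHull ℝ (closure B) := by
  obtain ⟨b₀, hb₀⟩ := nonempty_of_measure_ne_zero hB0.ne'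
  set e := (EuclideanSpace.basisFun (Fin d) ℝ).toBasis with he
  obtain ⟨w₀, hw₀B, hw₀⟩ := exists_mem_basis_det_ne_zero hB0 b₀
  have hcont : Continuous fun w : Fin d → EuclideanSpace ℝ (Fin d) =>
      |e.det fun i => w i - b₀| := by
    simp only [Module.Basis.det_apply]
    refine continuous_abs.comp (Continuous.matrix_det ?_)
    refine continuous_matrix fun i j => ?_
    simp only [Module.Basis.toMatrix_apply, he, OrthonormalBasis.coe_toBasis_repr_apply,
      EuclideanSpace.basisFun_repr]
    fun_prop
  have hK : IsCompact (Set.univ.pi fun _ : Fin d => closure B) :=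
    isCompact_univ_pi fun _ => hBb.isCompact_closure
  obtain ⟨w, hwK, hmax⟩ := hK.exists_isMaxOn ⟨w₀, fun i _ => subset_closure (hw₀B i)⟩
    hcont.continuousOn
  have hdet : 0 < |e.det fun i => w i - b₀| :=
    (abs_pos.2 hw₀).trans_le (hmax fun i _ => subset_closure (hw₀B i))
  set u : Fin d → EuclideanSpace ℝ (Fin d) := fun i => w i - b₀ with hu
  obtain ⟨hli, hsp⟩ := (Module.Basis.is_basis_iff_det e).2 (isUnit_iff_ne_zero.2 (abs_pos.1 hdet))
  let bu := Module.Basis.mk hli hsp.ge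
  let L : EuclideanSpace ℝ (Fin d) ≃L[ℝ] EuclideanSpace ℝ (Fin d) :=
    ((EuclideanSpace.equiv (Fin d) ℝ).toLinearEquiv.trans bu.equivFun.symm).toContinuousLinearEquiv
  have hL : ∀ y, L y = ∑ i, y i • u i := fun y => by
    change bu.equivFun.symm _ = _
    rw [Module.Basis.equivFun_symm_apply]
    simp [bu]
  refine ⟨b₀, L, fun y hy j => ?_, fun y hy0 hy1 => ?_⟩
  · have h1 : bu.coord j (L y) = y j := by
      change bu.equivFun (bu.equivFun.symm _) j = _
      rw [LinearEquiv.apply_symm_apply]; rfl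
    have h2 := LinearMap.congr_fun (e.det_smul_mk_coord_eq_det_update hli hsp.ge j) (L y)
    change e.det u * bu.coord j (L y) = e.det (Function.update u j (L y)) at h2
    -- Cramer's rule: the coordinate `y j` times the determinant of the frame is the determinant
    -- with its `j`-th vertex replaced by the point of `B`. Maximality then gives `|y j| ≤ 1`.
    rw [h1] at h2
    have h3 : Function.update u j (L y) = fun i => Function.update w j (b₀ + L y) i - b₀ := by
      funext i
      by_cases hij : i = j
      · subst hij; simp
      · simp [hij, hu]
    have h4 := hmax (a := Function.update w j (b₀ + L y)) fun i _ => by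
      by_cases hij : i = j
      · subst hij; simpa using subset_closure hy
      · simpa [hij] using hwK i trivial
    simp only [Set.mem_ofPred_eq] at h4
    rw [← h3, ← h2, abs_mul] at h4
    exact le_of_mul_le_mul_left (by simpa using h4) hdet
  -- Barycentric coordinates, with `none` standing for the origin `b₀` of the frame.
  · have h := (convex_convexHull ℝ (closure B)).sum_mem (t := Finset.univ)
      (w := fun o : Option (Fin d) => o.elim (1 - ∑ i, y i) fun i => y i)
      (z := fun o => o.elim b₀ w) (fun o _ => ?_) ?_ fun o _ => ?_
    · convert h using 1
      rw [Fintype.sum_option, hL]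
      simp only [Option.elim, hu, smul_sub, Finset.sum_sub_distrib, sub_smul, one_smul,
        Finset.sum_smul]
      abel
    · cases o with
      | none => simpa using hy1.le
      | some i => exact (hy0 i).le
    · rw [Fintype.sum_option]; simp
    · refine subset_convexHull ℝ _ ?_
      cases o with
      | none => exact subset_closure hb₀
      | some i => exact hwK i trivial

/-- Moving a point of `B` to the origin and dividing by the diameter puts `B` into the unit ball
with volume at least `1 / C`. -/
theorem exists_averagingSet_of_diam_pow_div_le (d : ℕ) (hd : 1 ≤ d) (p : ℕ) {C : ℝ} (hC : 0 < C) :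
    ∃ N : ℕ, ∀ n : ℕ, N ≤ n → ∀ B : Set (EuclideanSpace ℝ (Fin d)), MeasurableSet B →
      Bornology.IsBounded B → 0 < volume B → Metric.diam B ^ d / volume.real B ≤ C →
      ∃ x : Fin n → EuclideanSpace ℝ (Fin d),
        (∀ k, x k ∈ B) ∧ Function.Injective x ∧ IsAveragingSet B p x := by
  obtain ⟨N, hN⟩ := exists_averagingSet_of_affine d hd p 1 (inv_pos.2 hC)
  refine ⟨N, fun n hn B hB hBb hB0 hBC => ?_⟩
  have : Nonempty (Fin d) := ⟨⟨0, hd⟩⟩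
  obtain ⟨b₀, hb₀⟩ := nonempty_of_measure_ne_zero hB0.ne'
  have hV : 0 < volume.real B := ENNReal.toReal_pos hB0.ne' hBb.measure_lt_top.ne
  have hδ : 0 < Metric.diam B := by
    refine Metric.diam_nonneg.lt_of_ne fun h => hB0.ne' ?_
    refine Set.Subsingleton.measure_zero (fun x hx y hy => ?_) _
    exact dist_le_zero.1 ((Metric.dist_le_diam_of_mem hBb hx hy).trans h.ge)
  set δ := Metric.diam B
  refine hN n hn B hB hBb hB0 b₀
    (ContinuousLinearEquiv.smulLeft (Units.mk0 δ hδ.ne')) (fun y hy => ?_) ?_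
  · have h := Metric.dist_le_diam_of_mem hBb hy hb₀
    change dist (b₀ + δ • y) b₀ ≤ δ at h
    rw [dist_self_add_left, norm_smul, Real.norm_of_nonneg hδ.le] at h
    rw [mem_closedBall_zero_iff]
    exact le_of_mul_le_mul_left (by simpa using h) hδ
  · change _ ≤ volume ((fun y => δ • y) ⁻¹' ((fun z => b₀ + z) ⁻¹' B))
    rw [Measure.addHaar_preimage_smul _ hδ.ne', measure_preimage_add, finrank_euclideanSpace_fin,
      ← ENNReal.ofReal_toReal hBb.measure_lt_top.ne, ← ENNReal.ofReal_mul (abs_nonneg _)]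
    refine ENNReal.ofReal_le_ofReal ?_
    rw [abs_of_nonneg (by positivity), inv_mul_eq_div, inv_eq_one_div, div_le_div_iff₀ hC
      (by positivity), one_mul]
    rw [div_le_iff₀ hV] at hBC
    simpa [mul_comm, measureReal_def] using hBC

/-- In the maximal frame `B` lies in a fixed cube and the closure of its convex hull contains the
open standard simplex `O`. A convex set and its closure have the same volume, so the hull is at
least as large as `O`, and `B` has at least the fraction `1 / C` of that. -/
theorem exists_averagingSet_of_convexHull_div_le (d : ℕ) (hd : 1 ≤ d) (p : ℕ) {C : ℝ}
    (hC : 0 < C) :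
    ∃ N : ℕ, ∀ n : ℕ, N ≤ n → ∀ B : Set (EuclideanSpace ℝ (Fin d)), MeasurableSet B →
      Bornology.IsBounded B → 0 < volume B →
      volume.real (convexHull ℝ B) / volume.real B ≤ C →
      ∃ x : Fin n → EuclideanSpace ℝ (Fin d),
        (∀ k, x k ∈ B) ∧ Function.Injective x ∧ IsAveragingSet B p x := by
  set O : Set (EuclideanSpace ℝ (Fin d)) := {y | (∀ i, 0 < y i) ∧ ∑ i, y i < 1} with hO
  have hOopen : IsOpen O := by
    refine IsOpen.inter (s := {y : EuclideanSpace ℝ (Fin d) | ∀ i, 0 < y i})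
      (t := {y : EuclideanSpace ℝ (Fin d) | ∑ i, y i < 1}) ?_
      (isOpen_lt (by fun_prop) continuous_const)
    simp only [Set.ofPred_forall]
    exact isOpen_iInter_of_finite fun i => isOpen_lt continuous_const (by fun_prop)
  have hOne : O.Nonempty := by
    refine ⟨WithLp.toLp 2 fun _ => 1 / ((d : ℝ) + 1), fun i => by positivity, ?_⟩
    simp only [Finset.sum_const, Finset.card_univ, Fintype.card_fin, nsmul_eq_mul]
    rw [mul_one_div, div_lt_one (by positivity)]
    linarith
  have hOfin : volume O ≠ ⊤ := by
    refine (Metric.isBounded_closedBall.subset (t := Metric.closedBall 0 √d) fun y hy => ?_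
      ).measure_lt_top.ne
    rw [mem_closedBall_zero_iff]
    refine norm_le_sqrt_of_forall_abs_le_one fun i => abs_le.2 ⟨by linarith [hy.1 i], ?_⟩
    exact (Finset.single_le_sum (fun j _ => (hy.1 j).le) (Finset.mem_univ i)).trans hy.2.le
  have hOpos : 0 < volume.real O := ENNReal.toReal_pos (hOopen.measure_pos _ hOne).ne' hOfin
  obtain ⟨N, hN⟩ := exists_averagingSet_of_affine d hd p √d (div_pos hOpos hC)
  refine ⟨N, fun n hn B hB hBb hB0 hBC => ?_⟩
  have hV : 0 < volume.real B := ENNReal.toReal_pos hB0.ne' hBb.measure_lt_top.ne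
  obtain ⟨v, L, hcube, hsimplex⟩ := exists_affine_normalization hBb hB0
  refine hN n hn B hB hBb hB0 v L (fun y hy => ?_) ?_
  · rw [mem_closedBall_zero_iff]
    exact norm_le_sqrt_of_forall_abs_le_one (hcube y hy)
  obtain ⟨r, hr⟩ := exists_volume_preimage_affine_eq_mul v L
  have hhull : volume (convexHull ℝ B) ≤ ENNReal.ofReal C * volume B := by
    rw [← ENNReal.ofReal_toReal (isBounded_convexHull.2 hBb).measure_lt_top.ne,
      ← ENNReal.ofReal_toReal hBb.measure_lt_top.ne, ← ENNReal.ofReal_mul hC.le]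
    exact ENNReal.ofReal_le_ofReal ((div_le_iff₀ hV).1 hBC)
  have hOle : volume O ≤ ENNReal.ofReal C * (r * volume B) := by
    calc volume O ≤ volume ((fun y => v + L y) ⁻¹' closure (convexHull ℝ B)) := by
          refine measure_mono fun y hy => ?_
          exact convexHull_min (closure_mono (subset_convexHull ℝ B))
            (convex_convexHull ℝ B).closure (hsimplex y hy.1 hy.2)
      _ = r * volume (convexHull ℝ B) := by
          rw [hr, (convex_convexHull ℝ B).measure_closure volume]
      _ ≤ r * (ENNReal.ofReal C * volume B) := by gcongr
      _ = _ := mul_left_comm _ _ _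
  rw [hr, ENNReal.ofReal_div_of_pos hC, ofReal_measureReal hOfin]
  exact ENNReal.div_le_of_le_mul' hOle

theorem theoremt (d : ℕ) (hd : 1 ≤ d) (p : ℕ) :
    (∀ C : ℝ, 0 < C → ∃ N : ℕ, ∀ n : ℕ, N ≤ n → ∀ B : Set (EuclideanSpace ℝ (Fin d)),
      MeasurableSet B → Bornology.IsBounded B → 0 < volume B → volume (frontier B) = 0 →
      (Metric.diam B ^ d / volume.real B ≤ C ∨
        volume.real (convexHull ℝ B) / volume.real B ≤ C) →
      ∃ x : Fin n → EuclideanSpace ℝ (Fin d),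
        (∀ k, x k ∈ B) ∧ Function.Injective x ∧ IsAveragingSet B p x) ∧
    (∃ N : ℕ, ∀ n : ℕ, N ≤ n → ∀ B : Set (EuclideanSpace ℝ (Fin d)),
      MeasurableSet B → Bornology.IsBounded B → 0 < volume B → Convex ℝ B →
      ∃ x : Fin n → EuclideanSpace ℝ (Fin d),
        (∀ k, x k ∈ B) ∧ Function.Injective x ∧ IsAveragingSet B p x) := by
  refine ⟨fun C hC => ?_, ?_⟩
  · obtain ⟨N₁, h₁⟩ := exists_averagingSet_of_diam_pow_div_le d hd p hC
    obtain ⟨N₂, h₂⟩ := exists_averagingSet_of_convexHull_div_le d hd p hC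
    refine ⟨max N₁ N₂, fun n hn B hB hBb hB0 _ h => ?_⟩
    rcases h with h | h
    · exact h₁ n ((le_max_left _ _).trans hn) B hB hBb hB0 h
    · exact h₂ n ((le_max_right _ _).trans hn) B hB hBb hB0 h
  · obtain ⟨N, hN⟩ := exists_averagingSet_of_convexHull_div_le d hd p one_pos
    refine ⟨N, fun n hn B hB hBb hB0 hconv => hN n hn B hB hBb hB0 ?_⟩
    rw [hconv.convexHull_eq]
    exact div_self_le_one _
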